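/- Let $p>1$, $\kappa>0$, $\tilde\lambda>0$, $\tilde\sigma_a\ge 0$, $\sigma_s>0$, and set $\tilde\sigma=\sqrt{\tilde\lambda(\tilde\sigma_a^2+\sigma_s^2)}$, $\tilde\mu(a)=\kappa+\tilde\lambda a^{-p}$ for $a\in(0,\infty)$, and $\tilde\mu(\infty)=\kappa$. Let $B$ be a standard Brownian motion and, for $t\ge 0$, put $\widetilde X_t(0)=0$ and $\widetilde X_t(a)=\tilde\sigma B_t-\tilde\mu(a)t$ for $a\in(0,\infty]$. Let $\mathbb R_+=[0,\infty)$, let $\mathbf C(\mathbb R_+)$ be the space of continuous functions $\mathbb R_+\to\mathbb R$ with the topology of uniform convergence on compact sets, and let $\mathbb M$ be the space of finite nonnegative Borel measures on $\mathbb R_+$ with the topology of weak convergence. Let $\mathcal I$ be the set of finite initial conditions, i.e. of stochastic processes $w:\mathbb R_+\to\mathbb R_+$ with continuous nondecreasing paths that are independent of $B$ and satisfy $w(0)=0$, $\mathbb E\big[\int_0^1 w(a)a^{-2}\,da\big]<\infty$ and $\mathbb E[w(\infty)]<\infty$, where $w(\infty)=\lim_{a\to\infty}w(a)$. For $w\in\mathcal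 I$, $t\ge0$ and $a\in[0,\infty]$ let $$\widetilde W^w_t(a)=\chi_t(a)-\Big(\inf_{0\le s\le t}\chi_s(a)\Big)\wedge 0,\qquad \chi_s(a)=w(a)+\widetilde X_s(a),$$ and $\widetilde M_*(a)=\sup_{t\ge0}\widetilde X_t(a)$. For $f=\widetilde W^w_t$ and $f=\widetilde M_*$ let $\widetilde{\mathcal Z}^w_t$ and $\widetilde{\mathcal M}_*$, respectively, be the measure $\zeta$ on $\mathbb R_+$ with $$\zeta(\{0\})=0,\qquad \zeta([0,a])=\int_0^a\frac{f(x)}{x^2}\,dx+\frac{f(a)}{a}\ \ (0<a<\infty),\qquad \zeta(\mathbb R_+)=\int_0^\infty\frac{f(x)}{x^2}\,dx.$$ Then almost surely $\widetilde M_*(a)<\infty$ for all $a\in[0,\infty]$, and $(\widetilde M_*(\cdot),\widetilde M_*(\infty),\widetilde{\mathcal M}_*)$ is a well-defined element of $\mathbf C(\mathbb R_+)\times\mathbb R_+\times\mathbb M$; likewise, for every $w\in\mathcal I$ and $t\ge0$, almost surely $(\widetilde W^w_t(\cdot),\widetilde W^w_t(\infty),\widetilde{\mathcal Z}^w_t)$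 is. For every $w\in\mathcal I$, $$(\widetilde W^w_t(\cdot),\widetilde W^w_t(\infty),\widetilde{\mathcal Z}^w_t)\ \longrightarrow\ (\widetilde M_*(\cdot),\widetilde M_*(\infty),\widetilde{\mathcal M}_*)\quad\text{in distribution in }\mathbf C(\mathbb R_+)\times\mathbb R_+\times\mathbb M\text{ as }t\to\infty.$$ Moreover, the distribution of $(\widetilde M_*(\cdot),\widetilde M_*(\infty),\widetilde{\mathcal M}_*)$ is the unique stationary distribution of the process $(\widetilde W_t(\cdot),\widetilde W_t(\infty),\widetilde{\mathcal Z}_t)_{t\ge0}$. Here a probability measure $\pi$ on $\mathbf C(\mathbb R_+)\times\mathbb R_+\times\mathbb M$ is called a stationary distribution if it is the law of the initial triple $(\widetilde W^w_0(\cdot),\widetilde W^w_0(\infty),\widetilde{\mathcal Z}^w_0)$ for some finite initial condition $w$ (on some probability space carrying a standard Brownian motion), and if, whenever the initial triple of such a process has law $\pi$, the triple at every time $t\ge0$ has law $\pi$. -/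

import Mathlib

open MeasureTheory ProbabilityTheory Filter
open scoped NNReal ENNReal Topology

universe u

noncomputable section

namespace SRPT

/-! ### Reflecting coupled Brownian motions, path by path

Times are elements of `ℝ≥0`, sizes are elements `a` of `[0, ∞]`, i.e. of `ℝ≥0∞`. -/

/-- The one-dimensional Skorokhod map `Ψ[f](t) = f(t) - (inf_{0 ≤ s ≤ t} f(s)) ∧ 0`. -/
def skorokhodMap (f : ℝ≥0 → ℝ) (t : ℝ≥0) : ℝ :=
  f t - min (sInf (f '' Set.Icc 0 t)) 0

/-- Coupled Brownian motions started from zero, with standard deviation `σ` and drift function `μ`,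
driven by the path `b`: `X_t(0) = 0` and `X_t(a) = σ b_t - μ(a) t` for `a ∈ (0, ∞]`. -/
def coupledPath (σ : ℝ) (μ : ℝ≥0∞ → ℝ) (b : ℝ≥0 → ℝ) (t : ℝ≥0) (a : ℝ≥0∞) : ℝ :=
  if a = 0 then 0 else σ * b t - μ a * t

/-- `w(∞) = lim_{a → ∞} w(a)` of a nonnegative function, as an element of `[0, ∞]`. -/
def valueAtInfty (w : ℝ≥0 → ℝ) : ℝ≥0∞ :=
  limUnder atTop fun a : ℝ≥0 => ENNReal.ofReal (w a)

/-- The extension of `w` to `[0, ∞]` by its limit at infinity. -/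
def extendInfty (w : ℝ≥0 → ℝ) (a : ℝ≥0∞) : ℝ :=
  if a = ⊤ then (valueAtInfty w).toReal else w a.toNNReal

/-- Reflecting coupled Brownian motions with initial condition `w`, driven by the path `b`:
`W_t(a) = Ψ[χ(a)](t)` with `χ_s(a) = w(a) + X_s(a)`. -/
def reflectedPath (σ : ℝ) (μ : ℝ≥0∞ → ℝ) (b w : ℝ≥0 → ℝ) (t : ℝ≥0) (a : ℝ≥0∞) : ℝ :=
  skorokhodMap (fun s => extendInfty w a + coupledPath σ μ b s a) t

/-- The maximum process `M_*(a) = sup_{t ≥ 0} X_t(a)`. -/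
def maxPath (σ : ℝ) (μ : ℝ≥0∞ → ℝ) (b : ℝ≥0 → ℝ) (a : ℝ≥0∞) : ℝ :=
  ⨆ t : ℝ≥0, coupledPath σ μ b t a

/-! ### The state space -/

/-- `C(ℝ₊) × ℝ₊ × 𝕄`: continuous functions with the topology of uniform convergence on compact
sets, and finite Borel measures on `ℝ₊` with the topology of weak convergence. -/
abbrev State : Type := C(ℝ≥0, ℝ) × ℝ≥0 × FiniteMeasure ℝ≥0

instance instMeasurableSpaceState : MeasurableSpace State := borel State

instance instBorelSpaceState : BorelSpace State := ⟨rfl⟩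

/-- `ζ` is the measure on `ℝ₊` associated with `f`: `ζ {0} = 0`,
`ζ [0, a] = ∫_0^a f(x) / x² dx + f(a) / a` for `a ∈ (0, ∞)`, and
`ζ [0, ∞) = ∫_0^∞ f(x) / x² dx`. -/
structure IsQueueMeasure (f : ℝ≥0 → ℝ) (ζ : FiniteMeasure ℝ≥0) : Prop where
  zero : (ζ : Measure ℝ≥0) {0} = 0
  Icc : ∀ a : ℝ≥0, 0 < a → (ζ : Measure ℝ≥0) (Set.Icc 0 a) =
    (∫⁻ x in Set.Ioc (0 : ℝ) a, ENNReal.ofReal (f x.toNNReal / x ^ 2)) +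
      ENNReal.ofReal (f a / a)
  univ : (ζ : Measure ℝ≥0) Set.univ =
    ∫⁻ x in Set.Ioi (0 : ℝ), ENNReal.ofReal (f x.toNNReal / x ^ 2)

/-- `s` is the triple `(g(·), g(∞), ζ)` where `ζ` is the measure associated with `g(·)`. -/
structure IsStateOf (g : ℝ≥0∞ → ℝ) (s : State) : Prop where
  workload : ∀ a : ℝ≥0, s.1 a = g a
  total : (s.2.1 : ℝ) = g ⊤
  queue : IsQueueMeasure (fun a : ℝ≥0 => g a) s.2.2

open Classical in
/-- The triple `(g(·), g(∞), ζ)` determined by `g`; the value is the zero state if there is no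
such triple in the state space. -/
def stateOf (g : ℝ≥0∞ → ℝ) : State :=
  if h : ∃ s, IsStateOf g s then h.choose else (0, 0, 0)

/-! ### The SRPT scaling limit for heavy tails -/

/-- The parameters of the scaling limit: the processing time distribution has a regularly varying
tail of index `-(p + 1)` and standard deviation `σs`, `lam` is the limiting arrival rate, `σa` is
the limiting standard deviation of the interarrival times, and `κ` is the heavy traffic
parameter. -/
structure Params where
  p : ℝ
  κ : ℝ
  lam : ℝ
  σa : ℝ
  σs : ℝ
  one_lt_p : 1 < p
  κ_pos : 0 < κ
  lam_pos : 0 < lam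
  σa_nonneg : 0 ≤ σa
  σs_pos : 0 < σs

/-- The standard deviation `√(λ (σ_a² + σ_s²))`. -/
def Params.σ (θ : Params) : ℝ := √(θ.lam * (θ.σa ^ 2 + θ.σs ^ 2))

/-- The drift function, `κ + λ a^{-p}` for `a ∈ (0, ∞)` and `κ` for `a = ∞` (its value at `0` is
never used). -/
def Params.μ (θ : Params) (a : ℝ≥0∞) : ℝ :=
  if a = ⊤ then θ.κ else θ.κ + θ.lam * a.toReal ^ (-θ.p)

variable {Ω : Type*} [MeasurableSpace Ω]

/-- The finite initial conditions: processes `w` independent of `B`, with continuous nondecreasing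
paths started at `w(0) = 0`, with `E[∫_0^1 w(a) / a² da] < ∞` and `E[w(∞)] < ∞`. -/
structure IsFiniteInitialCondition (w B : ℝ≥0 → Ω → ℝ) (P : Measure Ω) : Prop where
  aemeasurable : ∀ a, AEMeasurable (w a) P
  indep : IndepFun (fun ω a => w a ω) (fun ω t => B t ω) P
  paths : ∀ᵐ ω ∂P, Continuous (fun a => w a ω) ∧ Monotone (fun a => w a ω) ∧ w 0 ω = 0
  near_zero : ∫⁻ ω, (∫⁻ a in Set.Ioc (0 : ℝ) 1, ENNReal.ofReal (w a.toNNReal ω / a ^ 2)) ∂P < ⊤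
  at_infty : ∫⁻ ω, valueAtInfty (fun a => w a ω) ∂P < ⊤

/-- `a ↦ W_t(a)` on `[0, ∞]`, for the SRPT scaling limit with initial condition `w`. -/
def workload (θ : Params) (B w : ℝ≥0 → Ω → ℝ) (t : ℝ≥0) (ω : Ω) : ℝ≥0∞ → ℝ :=
  reflectedPath θ.σ θ.μ (fun s => B s ω) (fun a => w a ω) t

/-- The SRPT scaling limit `(W_t(·), W_t(∞), Z_t)` with initial condition `w`, as a random element
of the state space for each `t`. -/
def scalingLimit (θ : Params) (B w : ℝ≥0 → Ω → ℝ) (t : ℝ≥0) (ω : Ω) : State :=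
  stateOf (workload θ B w t ω)

/-- `a ↦ M_*(a)` on `[0, ∞]`. -/
def maxProcess (θ : Params) (B : ℝ≥0 → Ω → ℝ) (ω : Ω) : ℝ≥0∞ → ℝ :=
  maxPath θ.σ θ.μ (fun s => B s ω)

/-- The triple formed by `M_*(·)`, `M_*(∞)` and the measure associated with `M_*(·)`. -/
def maxState (θ : Params) (B : ℝ≥0 → Ω → ℝ) (ω : Ω) : State :=
  stateOf (maxProcess θ B ω)

/-- A stationary distribution of the SRPT scaling limit: a law `π` on the state space which is the
law of the initial state for some finite initial condition, and such that the scaling limit has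
law `π` at every time whenever its initial state has law `π`. -/
structure IsStationaryLaw (θ : Params) (π : Measure State) : Prop where
  isProbabilityMeasure : IsProbabilityMeasure π
  realizable : ∃ (Ω : Type u) (_ : MeasurableSpace Ω) (P : Measure Ω) (B w : ℝ≥0 → Ω → ℝ),
    IsProbabilityMeasure P ∧ IsBrownianReal B P ∧ IsFiniteInitialCondition w B P ∧
      P.map (scalingLimit θ B w 0) = π
  invariant : ∀ (Ω : Type u) [MeasurableSpace Ω] (P : Measure Ω) [IsProbabilityMeasure P]
    (B w : ℝ≥0 → Ω → ℝ), IsBrownianReal B P → IsFiniteInitialCondition w B P →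
      P.map (scalingLimit θ B w 0) = π → ∀ t : ℝ≥0, P.map (scalingLimit θ B w t) = π

end SRPT

end

namespace SRPT

/-! ### Borel measurability of random finite measures and random continuous functions -/

section FiniteMeasureBorel

variable {X Ω : Type*} [MeasurableSpace X] [MeasurableSpace Ω]

/-- The unit mass at a point, as a finite measure. -/
noncomputable def diracFinite (x : X) : FiniteMeasure X := ⟨Measure.dirac x, inferInstance⟩

lemma finiteMeasure_map_simpleFunc (ζ : FiniteMeasure X) (T : SimpleFunc X X) :
    ζ.map T = ∑ x ∈ T.range, ζ (T ⁻¹' {x}) • diracFinite x := by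
  apply FiniteMeasure.toMeasure_injective
  rw [FiniteMeasure.toMeasure_map, FiniteMeasure.toMeasure_sum]
  refine Measure.ext fun s hs => ?_
  have h1 := SimpleFunc.map_lintegral (μ := (ζ : Measure X)) (s.indicator (1 : X → ℝ≥0∞)) T
  have h2 : (T.map (s.indicator (1 : X → ℝ≥0∞))).lintegral (ζ : Measure X) =
      (ζ : Measure X) (T ⁻¹' s) := by
    rw [← SimpleFunc.lintegral_eq_lintegral, ← lintegral_indicator_one (T.measurable hs)]
    rfl
  rw [Measure.map_apply T.measurable hs, ← h2, h1, Measure.finsetSum_apply]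
  refine Finset.sum_congr rfl fun x _ => ?_
  rw [FiniteMeasure.toMeasure_smul, Measure.smul_apply]
  simp [diracFinite, hs, mul_comm, ENNReal.smul_def]

variable [TopologicalSpace X] [BorelSpace X]

/-- The image of a random finite measure under a simple function is Borel measurable for the
topology of weak convergence. -/
lemma measurable_borel_map_simpleFunc {Z : Ω → FiniteMeasure X} (hZ : Measurable Z)
    (T : SimpleFunc X X) :
    Measurable[_, borel (FiniteMeasure X)] (fun ω => (Z ω).map T) := by
  have hcont : Continuous fun c : T.range → ℝ≥0 => ∑ x : T.range, c x • diracFinite (x : X) := by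
    fun_prop
  have hm : Measurable fun ω => fun x : T.range => (Z ω) (T ⁻¹' {(x : X)}) := by
    refine measurable_pi_lambda _ fun x => ENNReal.measurable_toNNReal.comp ?_
    exact (Measure.measurable_coe (T.measurableSet_fiber x)).comp (measurable_subtype_coe.comp hZ)
  let : MeasurableSpace (FiniteMeasure X) := borel _
  have : BorelSpace (FiniteMeasure X) := ⟨rfl⟩
  convert hcont.measurable.comp hm using 2 with ω
  rw [finiteMeasure_map_simpleFunc, ← Finset.sum_coe_sort]
  rfl

variable [TopologicalSpace.PseudoMetrizableSpace X] [TopologicalSpace.SeparableSpace X]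

/-- A random probability measure is Borel measurable for the topology of weak convergence. -/
lemma measurable_borel_probabilityMeasure [Nonempty X] {Z : Ω → ProbabilityMeasure X}
    (hZ : Measurable Z) : Measurable[_, borel (ProbabilityMeasure X)] Z := by
  let := TopologicalSpace.pseudoMetrizableSpacePseudoMetric X
  let T := SimpleFunc.approxOn (id : X → X) measurable_id Set.univ (Classical.arbitrary X)
    (Set.mem_univ _)
  have hT (x : X) : Tendsto (fun n => T n x) atTop (𝓝 x) :=
    SimpleFunc.tendsto_approxOn measurable_id _ (by simp)
  have hlim : ∀ ω, Tendsto (fun n => (Z ω).map (T n).measurable.aemeasurable) atTop (𝓝 (Z ω)) := by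
    intro ω
    rw [ProbabilityMeasure.tendsto_iff_forall_lintegral_tendsto]
    intro f
    have h : ∀ n, ∫⁻ x, (f x : ℝ≥0∞) ∂((Z ω).map (T n).measurable.aemeasurable : Measure X) =
        ∫⁻ x, (f (T n x) : ℝ≥0∞) ∂(Z ω : Measure X) := fun n => by
      rw [ProbabilityMeasure.toMeasure_map, lintegral_map (by fun_prop) (T n).measurable]
    simp_rw [h]
    refine tendsto_lintegral_of_dominated_convergence (fun _ => ((nndist f 0 : ℝ≥0) : ℝ≥0∞))
      (fun n => ?_) (fun n => ae_of_all _ fun x => ?_) ?_ (ae_of_all _ fun x => ?_)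
    · exact (f.continuous.measurable.comp (T n).measurable).coe_nnreal_ennreal
    · have := f.nndist_coe_le_nndist (g := 0) (T n x)
      rw [BoundedContinuousFunction.coe_zero, Pi.zero_apply, NNReal.nndist_zero_eq_val'] at this
      exact ENNReal.coe_le_coe.2 this
    · simp
    · exact ENNReal.tendsto_coe.2 ((f.continuous.tendsto x).comp (hT x))
  have hfm : Measurable fun ω => (Z ω).toFiniteMeasure :=
    (measurable_subtype_coe.comp hZ).subtype_mk
  have hn : ∀ n, Measurable[_, borel (ProbabilityMeasure X)]
      fun ω => (Z ω).map (T n).measurable.aemeasurable := by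
    intro n
    have hind := (ProbabilityMeasure.toFiniteMeasure_isEmbedding X).eq_induced
    rw [hind, borel_comap]
    rw [measurable_comap_iff]
    convert measurable_borel_map_simpleFunc hfm (T n) using 2 with ω
    apply FiniteMeasure.toMeasure_injective
    simp [FiniteMeasure.toMeasure_map]
  let : MeasurableSpace (ProbabilityMeasure X) := borel _
  have : BorelSpace (ProbabilityMeasure X) := ⟨rfl⟩
  exact measurable_of_tendsto_metrizable hn (tendsto_pi_nhds.2 hlim)

/-- A random finite measure is Borel measurable for the topology of weak convergence. -/
lemma measurable_borel_finiteMeasure [Nonempty X] {Z : Ω → FiniteMeasure X}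
    (hZ : Measurable Z) : Measurable[_, borel (FiniteMeasure X)] Z := by
  have hZm : Measurable fun ω => (Z ω : Measure X) := measurable_subtype_coe.comp hZ
  have hmass : Measurable fun ω => (Z ω).mass :=
    ENNReal.measurable_toNNReal.comp ((Measure.measurable_coe MeasurableSet.univ).comp hZm)
  have hnorm : Measurable fun ω => (Z ω).normalize := by
    refine Measurable.subtype_mk (Measure.measurable_of_measurable_coe _ fun s hs => ?_)
    have h : ∀ ω, ((Z ω).normalize : Measure X) s =
        if (Z ω).mass = 0 then Measure.dirac (Nonempty.some ‹_›) s
        else ((Z ω).mass⁻¹ : ℝ≥0) * (Z ω : Measure X) s := by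
      intro ω
      by_cases h0 : (Z ω).mass = 0
      · simp [FiniteMeasure.normalize, h0]
      · simp [FiniteMeasure.normalize, h0, ENNReal.smul_def]
    change Measurable fun ω => ((Z ω).normalize : Measure X) s
    simp_rw [h]
    refine Measurable.ite (hmass (measurableSet_singleton 0)) measurable_const ?_
    exact hmass.inv.coe_nnreal_ennreal.mul ((Measure.measurable_coe hs).comp hZm)
  have hnorm' := measurable_borel_probabilityMeasure hnorm
  have hcont : Continuous fun q : ℝ≥0 × ProbabilityMeasure X => q.1 • q.2.toFiniteMeasure :=
    continuous_fst.smul (ProbabilityMeasure.toFiniteMeasure_continuous.comp continuous_snd)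
  let : MeasurableSpace (ProbabilityMeasure X) := borel _
  have : BorelSpace (ProbabilityMeasure X) := ⟨rfl⟩
  let : MeasurableSpace (FiniteMeasure X) := borel _
  have : BorelSpace (FiniteMeasure X) := ⟨rfl⟩
  convert hcont.measurable.comp (hmass.prodMk hnorm') using 1
  funext ω
  exact (Z ω).self_eq_mass_smul_normalize

end FiniteMeasureBorel

section ContinuousMapBorel

variable {X Y Ω : Type*} [TopologicalSpace X] [TopologicalSpace Y]

lemma measurableSet_mapsTo_of_isCompact [MeasurableSpace Ω] [SecondCountableTopology X]
    [TopologicalSpace.PseudoMetrizableSpace Y] [MeasurableSpace Y]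
    [BorelSpace Y] {S : Ω → C(X, Y)} (hS : ∀ x, Measurable fun ω => S ω x)
    {K : Set X} (hK : IsCompact K) {U : Set Y} (hU : IsOpen U) :
    MeasurableSet {ω | Set.MapsTo (S ω) K U} := by
  let := TopologicalSpace.pseudoMetrizableSpacePseudoMetric Y
  obtain ⟨D, hDc, hDd⟩ := TopologicalSpace.exists_countable_dense K
  have : {ω | Set.MapsTo (S ω) K U} =
      ⋃ n : ℕ, ⋂ x ∈ D, (fun ω => S ω x) ⁻¹' {y | ((n : ℝ≥0∞) + 1)⁻¹ ≤ Metric.infEDist y Uᶜ} := by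
    ext ω
    simp only [Set.mem_ofPred_eq, Set.mem_iUnion, Set.mem_iInter, Set.mem_preimage]
    constructor
    · intro h
      have hcomp : IsCompact (S ω '' K) := hK.image (S ω).continuous
      obtain ⟨δ, hδ, hsub⟩ := hcomp.exists_thickening_subset_open hU h.image_subset
      obtain ⟨n, hn⟩ := ENNReal.exists_inv_nat_lt (ENNReal.ofReal_pos.2 hδ).ne'
      refine ⟨n, fun x _ => ?_⟩
      refine le_trans (ENNReal.inv_le_inv.2 (by simp)) (hn.le.trans ?_)
      refine Metric.le_infEDist.2 fun y hy => ?_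
      by_contra hlt
      rw [not_le] at hlt
      refine hy (hsub ?_)
      rw [Metric.mem_thickening_iff_exists_edist_lt]
      exact ⟨S ω x, ⟨x, x.2, rfl⟩, by rwa [edist_comm]⟩
    · rintro ⟨n, hn⟩ x hx
      have hcl : IsClosed {z : K | ((n : ℝ≥0∞) + 1)⁻¹ ≤ Metric.infEDist (S ω z) Uᶜ} :=
        isClosed_le continuous_const
          (Metric.continuous_infEDist.comp ((S ω).continuous.comp continuous_subtype_val))
      have hall : (⟨x, hx⟩ : K) ∈ {z : K | ((n : ℝ≥0∞) + 1)⁻¹ ≤ Metric.infEDist (S ω z) Uᶜ} :=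
        hcl.closure_subset_iff.2 (fun z hz => hn z hz) (hDd _)
      by_contra hxU
      have h0 : Metric.infEDist (S ω x) Uᶜ = 0 := Metric.infEDist_zero_of_mem hxU
      simp only [Set.mem_ofPred_eq, h0, nonpos_iff_eq_zero, ENNReal.inv_eq_zero] at hall
      exact absurd hall (by simp)
  rw [this]
  refine MeasurableSet.iUnion fun n => MeasurableSet.biInter hDc fun x _ => hS x ?_
  exact (isClosed_le continuous_const Metric.continuous_infEDist).measurableSet

/-- A random continuous function is Borel measurable for the topology of uniform convergence on
compact sets as soon as its values are measurable. -/
lemma measurable_borel_continuousMap [MeasurableSpace Ω] [SecondCountableTopology X]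
    [LocallyCompactSpace X] [SecondCountableTopology Y]
    [TopologicalSpace.PseudoMetrizableSpace Y] [MeasurableSpace Y]
    [BorelSpace Y] {S : Ω → C(X, Y)} (hS : ∀ x, Measurable fun ω => S ω x) :
    Measurable[_, borel C(X, Y)] S := by
  rw [borel_eq_generateFrom_of_subbasis ContinuousMap.compactOpen_eq]
  apply measurable_generateFrom
  rintro _ ⟨K, hK, U, hU, rfl⟩
  exact measurableSet_mapsTo_of_isCompact hS hK hU

end ContinuousMapBorel

/-! ### Random elements of the state space -/

/-- The states `(f, f(∞), ζ)` with `f` nondecreasing, `f(∞)` the limit of `f` at infinity, and `ζ`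
the measure associated with `f`. They are determined by the values of `f` on a dense set. -/
structure IsConsistent (s : State) : Prop where
  mono : Monotone s.1
  isLUB : IsLUB (Set.range s.1) (s.2.1 : ℝ)
  queue : IsQueueMeasure s.1 s.2.2

/-- The values of the workload component of a state on a dense sequence. -/
noncomputable def sample (s : State) (n : ℕ) : ℝ := s.1 (TopologicalSpace.denseSeq ℝ≥0 n)

lemma isQueueMeasure_zero : IsQueueMeasure (fun _ => 0) 0 where
  zero := by simp
  Icc a _ := by simp
  univ := by simp

lemma isConsistent_zero : IsConsistent (0, 0, 0) where
  mono := fun _ _ _ => le_rfl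
  isLUB := by
    have : Set.range (0 : C(ℝ≥0, ℝ)) = {0} := by ext x; simp
    rw [this]
    simp
  queue := isQueueMeasure_zero

/-- The measure associated with a random continuous function depends measurably on it. -/
lemma measurable_queueMeasure {Ω : Type*} [MeasurableSpace Ω] {f : Ω → C(ℝ≥0, ℝ)}
    (hf : ∀ x, Measurable fun ω => f ω x) {ζ : Ω → FiniteMeasure ℝ≥0}
    (hζ : ∀ ω, IsQueueMeasure (f ω) (ζ ω)) : Measurable ζ := by
  have hunc : Measurable (Function.uncurry fun (ω : Ω) (x : ℝ) =>
      ENNReal.ofReal (f ω x.toNNReal / x ^ 2)) := by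
    have h1 : Measurable (Function.uncurry fun (x : ℝ≥0) (ω : Ω) => f ω x) :=
      measurable_uncurry_of_continuous_of_measurable (fun ω => (f ω).continuous) hf
    have h2 : Measurable fun q : Ω × ℝ => f q.1 q.2.toNNReal :=
      h1.comp ((measurable_real_toNNReal.comp measurable_snd).prodMk measurable_fst)
    exact ENNReal.measurable_ofReal.comp (h2.div (measurable_snd.pow_const 2))
  suffices hmeas : Measurable fun ω => (ζ ω : Measure ℝ≥0) from hmeas.subtype_mk
  refine Measurable.measure_of_isPiSystem
    (borel_eq_generateFrom_Iic ℝ≥0 ▸ BorelSpace.measurable_eq) isPiSystem_Iic ?_ ?_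
  · rintro _ ⟨a, rfl⟩
    rcases eq_zero_or_pos a with rfl | ha
    · have : ∀ ω, (ζ ω : Measure ℝ≥0) (Set.Iic 0) = 0 := fun ω => by
        rw [← Set.Icc_bot]; simpa using (hζ ω).zero
      simp only [this]
      exact measurable_const
    · have : ∀ ω, (ζ ω : Measure ℝ≥0) (Set.Icc 0 a) = _ := fun ω => (hζ ω).Icc a ha
      simp only [← Set.Icc_bot, bot_eq_zero', this]
      exact hunc.lintegral_prod_right'.add (ENNReal.measurable_ofReal.comp ((hf a).div_const _))
  · have : ∀ ω, (ζ ω : Measure ℝ≥0) Set.univ = _ := fun ω => (hζ ω).univ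
    simp only [this]
    exact hunc.lintegral_prod_right'

/-- A random consistent state is measurable if its values on a dense sequence are. -/
lemma measurable_of_isConsistent {Ω : Type*} [MeasurableSpace Ω] {S : Ω → State}
    (hS : ∀ ω, IsConsistent (S ω)) (hm : Measurable fun ω => sample (S ω)) : Measurable S := by
  have hx : ∀ x, Measurable fun ω => (S ω).1 x := by
    intro x
    obtain ⟨u, hu, hux⟩ := mem_closure_iff_seq_limit.1
      ((TopologicalSpace.denseRange_denseSeq ℝ≥0) x)
    choose k hk using hu
    refine measurable_of_tendsto_metrizable (f := fun n ω => (S ω).1 (u n)) (fun n => ?_) ?_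
    · rw [← hk n]; exact (measurable_pi_apply (k n)).comp hm
    · exact tendsto_pi_nhds.2 fun ω => ((S ω).1.continuous.tendsto x).comp hux
  have h1 := measurable_borel_continuousMap hx
  have h2 : Measurable fun ω => (S ω).2.1 := by
    have : ∀ ω, (S ω).2.1 = (⨆ n : ℕ, (S ω).1 n).toNNReal := by
      intro ω
      have hl : IsLUB (Set.range fun n : ℕ => (S ω).1 n) ((S ω).2.1 : ℝ) := by
        refine ⟨?_, fun c hc => (hS ω).isLUB.2 ?_⟩
        · rintro _ ⟨n, rfl⟩; exact (hS ω).isLUB.1 ⟨_, rfl⟩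
        · rintro _ ⟨x, rfl⟩
          obtain ⟨n, hn⟩ := exists_nat_ge x
          exact ((hS ω).mono hn).trans (hc ⟨n, rfl⟩)
      rw [iSup, hl.csSup_eq (Set.range_nonempty _), Real.toNNReal_coe]
    simp_rw [this]
    exact measurable_real_toNNReal.comp (Measurable.iSup fun n => hx n)
  have h3 := measurable_borel_finiteMeasure (measurable_queueMeasure hx fun ω => (hS ω).queue)
  let m1 : MeasurableSpace C(ℝ≥0, ℝ) := borel _
  have b1 : BorelSpace C(ℝ≥0, ℝ) := ⟨rfl⟩
  let m2 : MeasurableSpace (FiniteMeasure ℝ≥0) := borel _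
  have b2 : BorelSpace (FiniteMeasure ℝ≥0) := ⟨rfl⟩
  have hb : instMeasurableSpaceState = Prod.instMeasurableSpace :=
    (Prod.borelSpace (α := C(ℝ≥0, ℝ)) (β := ℝ≥0 × FiniteMeasure ℝ≥0)).measurable_eq.symm
  rw [hb]
  exact h1.prodMk (h2.prodMk h3)

section Law

variable {Ω Ω' : Type*} [MeasurableSpace Ω] [MeasurableSpace Ω'] {P : Measure Ω} {P' : Measure Ω'}

/-- An almost surely consistent random state has a version that is measurable and everywhere
consistent. -/
lemma exists_measurable_consistent_version {S : Ω → State} (hS : ∀ᵐ ω ∂P, IsConsistent (S ω))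
    (hm : AEMeasurable (fun ω => sample (S ω)) P) :
    ∃ S' : Ω → State, Measurable S' ∧ (∀ ω, IsConsistent (S' ω)) ∧ S =ᵐ[P] S' := by
  classical
  obtain ⟨N, hN, hNm, hN0⟩ := exists_measurable_superset_of_null
    (show P {ω | ¬ (IsConsistent (S ω) ∧ sample (S ω) = hm.mk _ ω)} = 0 from
      ae_iff.1 (hS.and hm.ae_eq_mk))
  have hgood : ∀ ω, ω ∉ N → IsConsistent (S ω) ∧ sample (S ω) = hm.mk _ ω := fun ω hω => by
    by_contra h; exact hω (hN h)
  refine ⟨fun ω => if ω ∈ N then (0, 0, 0) else S ω, ?_, ?_, ?_⟩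
  · refine measurable_of_isConsistent (fun ω => ?_) ?_
    · split_ifs with h
      exacts [isConsistent_zero, (hgood ω h).1]
    · have : (fun ω => sample (if ω ∈ N then (0, 0, 0) else S ω)) =
          fun ω => if ω ∈ N then sample (0, 0, 0) else hm.mk _ ω := by
        funext ω
        split_ifs with h
        exacts [rfl, (hgood ω h).2]
      rw [this]
      exact Measurable.ite hNm measurable_const hm.measurable_mk
  · intro ω
    dsimp only
    split_ifs with h
    exacts [isConsistent_zero, (hgood ω h).1]
  · filter_upwards [measure_eq_zero_iff_ae_notMem.1 hN0] with ω hω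
    simp [hω]

lemma aemeasurable_of_isConsistent {S : Ω → State} (hS : ∀ᵐ ω ∂P, IsConsistent (S ω))
    (hm : AEMeasurable (fun ω => sample (S ω)) P) : AEMeasurable S P :=
  let ⟨S', h1, _, h3⟩ := exists_measurable_consistent_version hS hm
  ⟨S', h1, h3⟩

/-- Among consistent states, every Borel set is determined by the values on a dense sequence. -/
lemma exists_measurableSet_sample {U : Set State} (hU : MeasurableSet U) :
    ∃ A : Set (ℕ → ℝ), MeasurableSet A ∧ ∀ s, IsConsistent s → (s ∈ U ↔ sample s ∈ A) := by
  let e : {s : State // IsConsistent s} → ℕ → ℝ := fun s => sample s.1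
  let m : MeasurableSpace {s : State // IsConsistent s} := MeasurableSpace.comap e inferInstance
  have hme : Measurable[m] e := comap_measurable e
  have := measurable_of_isConsistent (S := fun s : {s : State // IsConsistent s} => s.1)
    (fun s => s.2) hme
  obtain ⟨A, hA, hAU⟩ := this hU
  refine ⟨A, hA, fun s hs => ?_⟩
  have : (⟨s, hs⟩ : {s : State // IsConsistent s}) ∈ e ⁻¹' A ↔ s ∈ U := by rw [hAU]; rfl
  exact this.symm

lemma map_apply_eq_map_sample_apply {U : Set State} (hU : MeasurableSet U) {A : Set (ℕ → ℝ)}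
    (hA : MeasurableSet A) (hAU : ∀ s, IsConsistent s → (s ∈ U ↔ sample s ∈ A))
    {S : Ω → State} (hS : ∀ᵐ ω ∂P, IsConsistent (S ω))
    (hm : AEMeasurable (fun ω => sample (S ω)) P) :
    P.map S U = P.map (fun ω => sample (S ω)) A := by
  rw [Measure.map_apply_of_aemeasurable (aemeasurable_of_isConsistent hS hm) hU,
    Measure.map_apply_of_aemeasurable hm hA]
  refine measure_congr ?_
  filter_upwards [hS] with ω hω
  exact propext (hAU _ hω)

/-- The law of a random consistent state is determined by the law of its values on a dense
sequence. -/
lemma map_eq_of_map_sample_eq {S : Ω → State} {S' : Ω' → State}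
    (hS : ∀ᵐ ω ∂P, IsConsistent (S ω)) (hS' : ∀ᵐ ω ∂P', IsConsistent (S' ω))
    (hm : AEMeasurable (fun ω => sample (S ω)) P) (hm' : AEMeasurable (fun ω => sample (S' ω)) P')
    (h : P.map (fun ω => sample (S ω)) = P'.map (fun ω => sample (S' ω))) :
    P.map S = P'.map S' := by
  refine Measure.ext fun U hU => ?_
  obtain ⟨A, hA, hAU⟩ := exists_measurableSet_sample hU
  rw [map_apply_eq_map_sample_apply hU hA hAU hS hm,
    map_apply_eq_map_sample_apply hU hA hAU hS' hm', h]

end Law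

/-! ### The measure associated with a nondecreasing function -/

/-- A discrete version of `∫_0^1 f(x) / x² dx` for nondecreasing `f`. -/
noncomputable def dyadicSum (f : ℝ≥0 → ℝ) : ℝ≥0∞ :=
  ∑' n : ℕ, 2 ^ n * ENNReal.ofReal (f (2⁻¹ ^ n))

lemma dyadicSum_mono {f g : ℝ≥0 → ℝ} (h : ∀ a, f a ≤ g a) : dyadicSum f ≤ dyadicSum g :=
  ENNReal.tsum_le_tsum fun n => by gcongr; exact h _

lemma dyadicSum_add_le (f g : ℝ≥0 → ℝ) :
    dyadicSum (fun a => f a + g a) ≤ dyadicSum f + dyadicSum g := by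
  rw [dyadicSum, dyadicSum, dyadicSum, ← ENNReal.tsum_add]
  refine ENNReal.tsum_le_tsum fun n => ?_
  rw [← mul_add]
  gcongr
  exact ENNReal.ofReal_add_le

/-- The dyadic intervals decomposing `(0, 1]`. -/
def dyadicIoc (n : ℕ) : Set ℝ := Set.Ioc (2⁻¹ ^ (n + 1)) (2⁻¹ ^ n)

lemma volume_dyadicIoc (n : ℕ) : volume (dyadicIoc n) = ENNReal.ofReal (2⁻¹ ^ (n + 1)) := by
  rw [dyadicIoc, Real.volume_Ioc]
  congr 1
  ring

lemma iUnion_dyadicIoc : ⋃ n, dyadicIoc n = Set.Ioc (0 : ℝ) 1 := by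
  ext x
  simp only [Set.mem_iUnion, dyadicIoc, Set.mem_Ioc]
  constructor
  · rintro ⟨n, h1, h2⟩
    exact ⟨lt_trans (by positivity) h1, h2.trans (pow_le_one₀ (by norm_num) (by norm_num))⟩
  · rintro ⟨h1, h2⟩
    exact exists_nat_pow_near_of_lt_one h1 h2 (by norm_num) (by norm_num)

lemma pairwise_disjoint_dyadicIoc : Pairwise (Function.onFun Disjoint dyadicIoc) := by
  have h : Antitone fun n : ℕ => (2⁻¹ : ℝ) ^ n :=
    pow_right_anti₀ (by norm_num) (by norm_num)
  exact h.pairwise_disjoint_on_Ioc_succ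

lemma lintegral_Ioc_le_dyadicSum {f : ℝ≥0 → ℝ} (hf : Monotone f) (h0 : f 0 = 0) :
    ∫⁻ x in Set.Ioc (0 : ℝ) 1, ENNReal.ofReal (f x.toNNReal / x ^ 2) ≤ 2 * dyadicSum f := by
  rw [← iUnion_dyadicIoc, dyadicSum, ← ENNReal.tsum_mul_left]
  refine (lintegral_iUnion_le _ _).trans (ENNReal.tsum_le_tsum fun n => ?_)
  have hpos : 0 ≤ f (2⁻¹ ^ n) := h0 ▸ hf zero_le
  have hle : ∀ x ∈ dyadicIoc n, ENNReal.ofReal (f x.toNNReal / x ^ 2) ≤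
      ENNReal.ofReal (f (2⁻¹ ^ n) * 4 ^ (n + 1)) := by
    intro x hx
    have hx0 : (0 : ℝ) < 2⁻¹ ^ (n + 1) := by positivity
    refine ENNReal.ofReal_le_ofReal ?_
    rw [div_eq_mul_inv]
    have h1 : f x.toNNReal ≤ f (2⁻¹ ^ n) := hf (Real.toNNReal_le_iff_le_coe.2 (by simpa using hx.2))
    have h2 : (x ^ 2)⁻¹ ≤ 4 ^ (n + 1) := by
      rw [show (4 : ℝ) ^ (n + 1) = ((2⁻¹ ^ (n + 1)) ^ 2)⁻¹ by
        rw [← pow_mul, mul_comm, pow_mul, ← inv_pow]; norm_num]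
      gcongr
      exact hx.1.le
    exact mul_le_mul h1 h2 (by positivity) hpos
  refine (setLIntegral_mono_ae (by fun_prop) (ae_of_all _ hle)).trans ?_
  rw [setLIntegral_const, volume_dyadicIoc, ← ENNReal.ofReal_mul (by positivity)]
  rw [show (2 : ℝ≥0∞) = ENNReal.ofReal 2 by simp, ← ENNReal.ofReal_pow (by norm_num),
    ← ENNReal.ofReal_mul (by norm_num), ← ENNReal.ofReal_mul (by norm_num)]
  refine ENNReal.ofReal_le_ofReal (le_of_eq ?_)
  have : (4 : ℝ) ^ (n + 1) * 2⁻¹ ^ (n + 1) = 2 ^ (n + 1) := by rw [← mul_pow]; norm_num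
  rw [mul_assoc, this, pow_succ]
  ring

lemma dyadicSum_le_lintegral_Ioc {f : ℝ≥0 → ℝ} (hf : Monotone f) (h0 : f 0 = 0) :
    dyadicSum f ≤ ENNReal.ofReal (f 1) +
      4 * ∫⁻ x in Set.Ioc (0 : ℝ) 1, ENNReal.ofReal (f x.toNNReal / x ^ 2) := by
  rw [dyadicSum, tsum_eq_zero_add' ENNReal.summable, ← iUnion_dyadicIoc,
    lintegral_iUnion (s := dyadicIoc) (fun n => measurableSet_Ioc) pairwise_disjoint_dyadicIoc,
    ← ENNReal.tsum_mul_left]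
  simp only [pow_zero, one_mul]
  refine add_le_add le_rfl (ENNReal.tsum_le_tsum fun n => ?_)
  have hpos : 0 ≤ f (2⁻¹ ^ (n + 1)) := h0 ▸ hf zero_le
  have hle : ∀ x ∈ dyadicIoc n, ENNReal.ofReal (f (2⁻¹ ^ (n + 1)) * 4 ^ n) ≤
      ENNReal.ofReal (f x.toNNReal / x ^ 2) := by
    intro x hx
    have hx0 : 0 < x := lt_trans (by positivity) hx.1
    refine ENNReal.ofReal_le_ofReal ?_
    rw [div_eq_mul_inv]
    have h1 : f (2⁻¹ ^ (n + 1)) ≤ f x.toNNReal :=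
      hf ((Real.le_toNNReal_iff_coe_le hx0.le).2 (by simpa using hx.1.le))
    have h2 : 4 ^ n ≤ (x ^ 2)⁻¹ := by
      rw [show (4 : ℝ) ^ n = ((2⁻¹ ^ n) ^ 2)⁻¹ by
        rw [← pow_mul, mul_comm, pow_mul, ← inv_pow]; norm_num]
      gcongr
      exact hx.2
    exact mul_le_mul h1 h2 (by positivity) (hpos.trans h1)
  have := setLIntegral_mono_ae' (μ := volume) (s := dyadicIoc n) measurableSet_Ioc (ae_of_all _ hle)
  rw [setLIntegral_const, volume_dyadicIoc, ← ENNReal.ofReal_mul (by positivity)] at this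
  refine le_trans (le_of_eq ?_) (mul_le_mul_right this 4)
  rw [show (2 : ℝ≥0∞) = ENNReal.ofReal 2 by simp, show (4 : ℝ≥0∞) = ENNReal.ofReal 4 by simp,
    ← ENNReal.ofReal_pow (by norm_num),
    ← ENNReal.ofReal_mul (by positivity), ← ENNReal.ofReal_mul (by norm_num)]
  congr 1
  have : (4 : ℝ) ^ (n + 1) * 2⁻¹ ^ (n + 1) = 2 ^ (n + 1) := by rw [← mul_pow]; norm_num
  rw [← this]
  ring

lemma lintegral_Ioi_inv_sq {a : ℝ} (ha : 0 < a) :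
    ∫⁻ x in Set.Ioi a, ENNReal.ofReal (1 / x ^ 2) = ENNReal.ofReal (1 / a) := by
  have h1 := integral_Ioi_rpow_of_lt (a := -2) (by norm_num) ha
  have h2 := integrableOn_Ioi_rpow_of_lt (a := -2) (by norm_num) ha
  have h3 : ∀ x ∈ Set.Ioi a, x ^ (-2 : ℝ) = 1 / x ^ 2 := fun x hx => by
    have hx0 : 0 < x := ha.trans hx
    rw [Real.rpow_neg hx0.le, one_div]
    norm_num
  rw [integrableOn_congr_fun h3 measurableSet_Ioi] at h2
  rw [setIntegral_congr_fun measurableSet_Ioi h3] at h1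
  rw [← ofReal_integral_eq_lintegral_ofReal h2 (ae_of_all _ fun x => by positivity), h1]
  congr 1
  rw [show (-2 : ℝ) + 1 = -1 by norm_num, Real.rpow_neg_one]
  ring

lemma lintegral_Ioi_lt_top {f : ℝ≥0 → ℝ} (hf : Monotone f) (h0 : f 0 = 0) {C : ℝ}
    (hC : ∀ a, f a ≤ C) (hD : dyadicSum f < ⊤) :
    ∫⁻ x in Set.Ioi (0 : ℝ), ENNReal.ofReal (f x.toNNReal / x ^ 2) < ⊤ := by
  rw [← Set.Ioc_union_Ioi_eq_Ioi zero_le_one]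
  refine (lintegral_union_le _ _ _).trans_lt (ENNReal.add_lt_top.2 ⟨?_, ?_⟩)
  · exact (lintegral_Ioc_le_dyadicSum hf h0).trans_lt (ENNReal.mul_lt_top (by simp) hD)
  · have hC0 : 0 ≤ C := h0 ▸ hC 0
    have : ∀ x ∈ Set.Ioi (1 : ℝ), ENNReal.ofReal (f x.toNNReal / x ^ 2) ≤
        ENNReal.ofReal C * ENNReal.ofReal (1 / x ^ 2) := fun x _ => by
      rw [← ENNReal.ofReal_mul hC0, mul_one_div]
      gcongr
      exact hC _
    refine (setLIntegral_mono_ae (by fun_prop) (ae_of_all _ this)).trans_lt ?_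
    rw [lintegral_const_mul _ (by fun_prop), lintegral_Ioi_inv_sq one_pos]
    exact ENNReal.mul_lt_top (by simp) (by simp)

/-- The Stieltjes function on `ℝ` extending a nondecreasing continuous function on `ℝ₊`. -/
noncomputable def stieltjesOfNNReal {f : ℝ≥0 → ℝ} (hf : Monotone f) (hc : Continuous f) :
    StieltjesFunction ℝ where
  toFun x := f x.toNNReal
  mono' _ _ h := hf (Real.toNNReal_mono h)
  right_continuous' _ := (hc.comp continuous_real_toNNReal).continuousWithinAt

/-- Integrating `1 / x` against a nondecreasing function, by Tonelli's theorem. -/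
lemma lintegral_inv_stieltjes {ν : Measure ℝ} [SFinite ν] {s : Set ℝ} (hs : MeasurableSet s)
    (hs0 : s ⊆ Set.Ioi 0) :
    ∫⁻ x in s, ENNReal.ofReal (1 / x) ∂ν =
      ∫⁻ y in Set.Ioi (0 : ℝ), ν (s ∩ Set.Iic y) * ENNReal.ofReal (1 / y ^ 2) := by
  have h1 : ∀ x ∈ s, ENNReal.ofReal (1 / x) =
      ∫⁻ y in Set.Ioi (0 : ℝ), (Set.Ici x).indicator (fun y => ENNReal.ofReal (1 / y ^ 2)) y := by
    intro x hx
    have hx0 : 0 < x := hs0 hx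
    rw [lintegral_indicator measurableSet_Ici, Measure.restrict_restrict measurableSet_Ici,
      Set.inter_eq_left.2 (Set.Ici_subset_Ioi.2 hx0), ← lintegral_Ioi_inv_sq hx0]
    exact setLIntegral_congr Ioi_ae_eq_Ici
  rw [setLIntegral_congr_fun hs h1, lintegral_lintegral_swap]
  · refine lintegral_congr fun y => ?_
    have h2 : ∀ x, (Set.Ici x).indicator (fun y => ENNReal.ofReal (1 / y ^ 2)) y =
        (Set.Iic y).indicator (fun _ => ENNReal.ofReal (1 / y ^ 2)) x := fun x => by
      simp only [Set.indicator, Set.mem_Ici, Set.mem_Iic]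
    simp_rw [h2]
    rw [lintegral_indicator measurableSet_Iic, Measure.restrict_restrict measurableSet_Iic,
      setLIntegral_const, Set.inter_comm, mul_comm]
  · have h3 : (Function.uncurry fun x y : ℝ =>
        (Set.Ici x).indicator (fun y => ENNReal.ofReal (1 / y ^ 2)) y) =
        {q : ℝ × ℝ | q.1 ≤ q.2}.indicator fun q => ENNReal.ofReal (1 / q.2 ^ 2) := by
      funext q
      simp [Function.uncurry, Set.indicator]
    rw [h3]
    exact (Measurable.indicator (by fun_prop)
      (measurableSet_le measurable_fst measurable_snd)).aemeasurable

/-- The measure `df(x) / x` is the measure associated with `f`. -/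
lemma exists_isQueueMeasure {f : ℝ≥0 → ℝ} (hf : Monotone f) (hc : Continuous f) (h0 : f 0 = 0)
    {C : ℝ} (hC : ∀ a, f a ≤ C) (hD : dyadicSum f < ⊤) :
    ∃ ζ : FiniteMeasure ℝ≥0, IsQueueMeasure f ζ := by
  have hpos : ∀ a, 0 ≤ f a := fun a => h0 ▸ hf zero_le
  let ν := (stieltjesOfNNReal hf hc).measure
  have hν : ∀ a b : ℝ, ν (Set.Ioc a b) = ENNReal.ofReal (f b.toNNReal - f a.toNNReal) :=
    fun a b => StieltjesFunction.measure_Ioc _ _ _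
  let ζ : Measure ℝ≥0 :=
    ((ν.restrict (Set.Ioi 0)).withDensity fun x => ENNReal.ofReal (1 / x)).map Real.toNNReal
  have hζ : ∀ s : Set ℝ≥0, MeasurableSet s → ζ s =
      ∫⁻ y in Set.Ioi (0 : ℝ), ν ((Real.toNNReal ⁻¹' s ∩ Set.Ioi 0) ∩ Set.Iic y) *
        ENNReal.ofReal (1 / y ^ 2) := by
    intro s hs
    have hs' : MeasurableSet (Real.toNNReal ⁻¹' s) := measurable_real_toNNReal hs
    rw [Measure.map_apply measurable_real_toNNReal hs, withDensity_apply _ hs',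
      Measure.restrict_restrict hs']
    exact lintegral_inv_stieltjes (hs'.inter measurableSet_Ioi) Set.inter_subset_right
  have hcalc : ∀ y ∈ Set.Ioi (0 : ℝ), ENNReal.ofReal (f y.toNNReal) * ENNReal.ofReal (1 / y ^ 2) =
      ENNReal.ofReal (f y.toNNReal / y ^ 2) := fun y _ => by
    rw [← ENNReal.ofReal_mul (hpos _), mul_one_div]
  have huniv : ζ Set.univ = ∫⁻ x in Set.Ioi (0 : ℝ), ENNReal.ofReal (f x.toNNReal / x ^ 2) := by
    rw [hζ _ MeasurableSet.univ]
    refine setLIntegral_congr_fun measurableSet_Ioi fun y hy => ?_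
    simp only [Set.preimage_univ, Set.univ_inter, Set.Ioi_inter_Iic]
    rw [hν, ← hcalc y hy]
    simp [h0]
  have hfin : IsFiniteMeasure ζ := ⟨huniv ▸ lintegral_Ioi_lt_top hf h0 hC hD⟩
  refine ⟨⟨ζ, hfin⟩, ?_, fun a ha => ?_, huniv⟩
  · change ζ {0} = 0
    rw [hζ _ (measurableSet_singleton 0)]
    have : Real.toNNReal ⁻¹' {0} ∩ Set.Ioi 0 = ∅ := by
      ext x
      simp
    simp [this]
  · change ζ (Set.Icc 0 a) = _
    have ha' : (0 : ℝ) < a := ha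
    have hset : Real.toNNReal ⁻¹' Set.Icc 0 a ∩ Set.Ioi 0 = Set.Ioc (0 : ℝ) a := by
      ext x
      simp [Real.toNNReal_le_iff_le_coe, and_comm]
    rw [hζ _ measurableSet_Icc, hset, ← Set.Ioc_union_Ioi_eq_Ioi ha'.le,
      lintegral_union measurableSet_Ioi Set.Ioc_disjoint_Ioi_same]
    congr 1
    · refine setLIntegral_congr_fun measurableSet_Ioc fun y hy => ?_
      rw [Set.Ioc_inter_Iic, min_eq_right hy.2, hν, ← hcalc y hy.1]
      simp [h0]
    · have : ∀ y ∈ Set.Ioi (a : ℝ), ν (Set.Ioc 0 (a : ℝ) ∩ Set.Iic y) *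
          ENNReal.ofReal (1 / y ^ 2) = ENNReal.ofReal (f a) * ENNReal.ofReal (1 / y ^ 2) := by
        intro y hy
        rw [Set.Ioc_inter_Iic, min_eq_left (le_of_lt hy), hν]
        simp [h0]
      rw [setLIntegral_congr_fun measurableSet_Ioi this, lintegral_const_mul _ (by fun_prop),
        lintegral_Ioi_inv_sq ha', ← ENNReal.ofReal_mul (hpos _), mul_one_div]

/-! ### The drift function -/

section Drift

variable (θ : Params)

lemma Params.σ_pos : 0 < θ.σ := by
  have := θ.lam_pos
  have := θ.σs_pos
  exact Real.sqrt_pos.2 (by positivity)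

lemma Params.μ_top : θ.μ ⊤ = θ.κ := by simp [Params.μ]

lemma Params.μ_coe (a : ℝ≥0) : θ.μ a = θ.κ + θ.lam * (a : ℝ) ^ (-θ.p) := by simp [Params.μ]

lemma Params.κ_le_μ (a : ℝ≥0∞) : θ.κ ≤ θ.μ a := by
  unfold Params.μ
  split_ifs
  · exact le_rfl
  · have := θ.lam_pos
    have : 0 ≤ a.toReal ^ (-θ.p) := Real.rpow_nonneg ENNReal.toReal_nonneg _
    nlinarith

lemma Params.μ_pos (a : ℝ≥0∞) : 0 < θ.μ a := θ.κ_pos.trans_le (θ.κ_le_μ a)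

lemma Params.μ_anti {a a' : ℝ≥0∞} (ha : a ≠ 0) (h : a ≤ a') : θ.μ a' ≤ θ.μ a := by
  by_cases ht : a' = ⊤
  · rw [ht, θ.μ_top]; exact θ.κ_le_μ a
  · have hta : a ≠ ⊤ := ne_top_of_le_ne_top ht h
    simp only [Params.μ, ht, hta, if_false]
    have h1 : a.toReal ≤ a'.toReal := ENNReal.toReal_mono ht h
    have h2 := Real.rpow_le_rpow_of_nonpos (ENNReal.toReal_pos ha hta) h1
      (z := -θ.p) (by linarith [θ.one_lt_p])
    have := mul_le_mul_of_nonneg_left h2 θ.lam_pos.le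
    linarith

lemma Params.continuousAt_μ {a : ℝ≥0} (ha : a ≠ 0) :
    ContinuousAt (fun x : ℝ≥0 => θ.μ x) a := by
  simp only [Params.μ_coe]
  refine continuousAt_const.add (continuousAt_const.mul ?_)
  exact (NNReal.continuous_coe.continuousAt).rpow_const (Or.inl (by exact_mod_cast ha))

lemma Params.tendsto_μ_atTop : Tendsto (fun x : ℝ≥0 => θ.μ x) atTop (𝓝 (θ.μ ⊤)) := by
  simp only [Params.μ_coe, Params.μ_top]
  have h := (tendsto_rpow_neg_atTop (y := θ.p) (by linarith [θ.one_lt_p])).comp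
    (NNReal.tendsto_coe_atTop.2 tendsto_id)
  simpa using (h.const_mul θ.lam).const_add θ.κ

lemma Params.tendsto_μ_zero : Tendsto (fun x : ℝ≥0 => θ.μ x) (𝓝[≠] 0) atTop := by
  simp only [Params.μ_coe]
  refine tendsto_atTop_add_const_left _ _ (Tendsto.const_mul_atTop θ.lam_pos ?_)
  have h1 : Tendsto (fun x : ℝ≥0 => (x : ℝ)) (𝓝[≠] 0) (𝓝[>] 0) := by
    refine tendsto_nhdsWithin_iff.2 ⟨?_, ?_⟩
    · exact (NNReal.continuous_coe.tendsto' 0 0 rfl).mono_left nhdsWithin_le_nhds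
    · filter_upwards [self_mem_nhdsWithin] with x hx
      exact NNReal.coe_pos.2 (pos_iff_ne_zero.2 hx)
  exact (tendsto_rpow_neg_nhdsGT_zero (by linarith [θ.one_lt_p])).comp h1

end Drift

/-! ### Running maxima of coupled paths -/

/-- The running maximum `sup_{0 ≤ s ≤ t} X_s(a)`. -/
noncomputable def runningMax (θ : Params) (b : ℝ≥0 → ℝ) (t : ℝ≥0) (a : ℝ≥0∞) : ℝ :=
  sSup ((fun s => coupledPath θ.σ θ.μ b s a) '' Set.Icc 0 t)

/-- The time reversal of `reflectedPath`: the maximum of `w(a) + X_t(a)` and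
`sup_{0 ≤ s ≤ t} X_s(a)`. -/
noncomputable def dualPath (θ : Params) (b w : ℝ≥0 → ℝ) (t : ℝ≥0) (a : ℝ≥0∞) : ℝ :=
  max (extendInfty w a + coupledPath θ.σ θ.μ b t a) (runningMax θ b t a)

/-- Reversal of a path on `[0, t]`. -/
noncomputable def reversePath (b : ℝ≥0 → ℝ) (t s : ℝ≥0) : ℝ :=
  if s ≤ t then b t - b (t - s) else b s

section Paths

variable {θ : Params} {b w : ℝ≥0 → ℝ} {t : ℝ≥0}

lemma coupledPath_zero_right (s : ℝ≥0) : coupledPath θ.σ θ.μ b s 0 = 0 := by simp [coupledPath]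

lemma coupledPath_of_ne {a : ℝ≥0∞} (ha : a ≠ 0) (s : ℝ≥0) :
    coupledPath θ.σ θ.μ b s a = θ.σ * b s - θ.μ a * s := by simp [coupledPath, ha]

lemma coupledPath_zero_left (hb0 : b 0 = 0) (a : ℝ≥0∞) : coupledPath θ.σ θ.μ b 0 a = 0 := by
  simp [coupledPath, hb0]

lemma continuous_coupledPath (hb : Continuous b) (a : ℝ≥0∞) :
    Continuous fun s => coupledPath θ.σ θ.μ b s a := by
  by_cases ha : a = 0
  · simp [coupledPath, ha, continuous_const]
  · simp only [coupledPath_of_ne ha]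
    fun_prop

lemma coupledPath_mono {a a' : ℝ≥0∞} (ha : a ≠ 0) (h : a ≤ a') (s : ℝ≥0) :
    coupledPath θ.σ θ.μ b s a ≤ coupledPath θ.σ θ.μ b s a' := by
  rw [coupledPath_of_ne ha, coupledPath_of_ne (ne_of_gt ((pos_iff_ne_zero.2 ha).trans_le h))]
  have := mul_le_mul_of_nonneg_right (θ.μ_anti ha h) s.2
  exact sub_le_sub_left this _

lemma bddAbove_coupledPath_Icc (hb : Continuous b) (t : ℝ≥0) (a : ℝ≥0∞) :
    BddAbove ((fun s => coupledPath θ.σ θ.μ b s a) '' Set.Icc 0 t) :=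
  isCompact_Icc.bddAbove_image (continuous_coupledPath hb a).continuousOn

lemma coupledPath_le_runningMax (hb : Continuous b) {s : ℝ≥0} (hs : s ≤ t) (a : ℝ≥0∞) :
    coupledPath θ.σ θ.μ b s a ≤ runningMax θ b t a :=
  le_csSup (bddAbove_coupledPath_Icc hb t a) ⟨s, ⟨zero_le, hs⟩, rfl⟩

lemma runningMax_le {a : ℝ≥0∞} {c : ℝ} (h : ∀ s ≤ t, coupledPath θ.σ θ.μ b s a ≤ c) :
    runningMax θ b t a ≤ c := by
  refine csSup_le (Set.Nonempty.image _ ⟨0, by simp⟩) ?_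
  rintro _ ⟨s, hs, rfl⟩
  exact h s hs.2

lemma runningMax_nonneg (hb : Continuous b) (hb0 : b 0 = 0) (a : ℝ≥0∞) :
    0 ≤ runningMax θ b t a := by
  rw [← coupledPath_zero_left (θ := θ) hb0 a]
  exact coupledPath_le_runningMax hb zero_le a

lemma runningMax_zero_right : runningMax θ b t 0 = 0 := by
  have : ((fun s => coupledPath θ.σ θ.μ b s 0) '' Set.Icc 0 t) = {0} := by
    simp only [coupledPath_zero_right]
    exact Set.Nonempty.image_const ⟨0, by simp⟩ 0
  rw [runningMax, this, csSup_singleton]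

lemma runningMax_mono (hb : Continuous b) (hb0 : b 0 = 0) : Monotone (runningMax θ b t) := by
  intro a a' h
  by_cases ha : a = 0
  · rw [ha, runningMax_zero_right]; exact runningMax_nonneg hb hb0 a'
  · exact runningMax_le fun s hs => (coupledPath_mono ha h s).trans
      (coupledPath_le_runningMax hb hs a')

lemma runningMax_le_add (hb : Continuous b) {a a' : ℝ≥0∞} (ha : a ≠ 0) (ha' : a' ≠ 0) :
    runningMax θ b t a ≤ runningMax θ b t a' + t * |θ.μ a - θ.μ a'| := by
  refine runningMax_le fun s hs => ?_
  have h1 := coupledPath_le_runningMax (θ := θ) hb hs a'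
  rw [coupledPath_of_ne ha'] at h1
  rw [coupledPath_of_ne ha]
  have h2 : (θ.μ a' - θ.μ a) * s ≤ t * |θ.μ a - θ.μ a'| := by
    rw [mul_comm (t : ℝ), abs_sub_comm]
    exact mul_le_mul (le_abs_self _) (by exact_mod_cast hs) s.2 (abs_nonneg _)
  linarith

lemma abs_runningMax_sub_le (hb : Continuous b) {a a' : ℝ≥0∞} (ha : a ≠ 0) (ha' : a' ≠ 0) :
    |runningMax θ b t a - runningMax θ b t a'| ≤ t * |θ.μ a - θ.μ a'| := by
  rw [abs_sub_le_iff]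
  constructor
  · linarith [runningMax_le_add (θ := θ) (t := t) hb ha ha']
  · rw [abs_sub_comm]; linarith [runningMax_le_add (θ := θ) (t := t) hb ha' ha]

lemma tendsto_runningMax_of_tendsto_μ (hb : Continuous b) {l : Filter ℝ≥0} {a : ℝ≥0∞} (ha : a ≠ 0)
    (hl : ∀ᶠ x : ℝ≥0 in l, x ≠ 0) (h : Tendsto (fun x : ℝ≥0 => θ.μ x) l (𝓝 (θ.μ a))) :
    Tendsto (fun x : ℝ≥0 => runningMax θ b t x) l (𝓝 (runningMax θ b t a)) := by
  rw [tendsto_iff_dist_tendsto_zero]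
  have h2 : Tendsto (fun x : ℝ≥0 => t * |θ.μ x - θ.μ a|) l (𝓝 0) := by
    simpa using ((h.sub_const (θ.μ a)).abs).const_mul (t : ℝ)
  refine squeeze_zero' (Eventually.of_forall fun _ => dist_nonneg) ?_ h2
  filter_upwards [hl] with x hx
  rw [Real.dist_eq]
  exact abs_runningMax_sub_le hb (by exact_mod_cast hx) ha

lemma tendsto_runningMax_zero (hb : Continuous b) (hb0 : b 0 = 0) :
    Tendsto (fun x : ℝ≥0 => runningMax θ b t x) (𝓝 0) (𝓝 0) := by
  rw [← nhdsNE_sup_pure, tendsto_sup]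
  refine ⟨?_, ?_⟩
  swap
  · rw [tendsto_pure_left]
    intro s hs
    rw [ENNReal.coe_zero, runningMax_zero_right]
    exact mem_of_mem_nhds hs
  refine tendsto_order.2 ⟨fun c hc => Eventually.of_forall fun x =>
    hc.trans_le (runningMax_nonneg hb hb0 _), fun ε hε => ?_⟩
  have hcb : Continuous fun s => θ.σ * b s := by fun_prop
  have hnear : ∀ᶠ s in 𝓝 (0 : ℝ≥0), θ.σ * b s < ε / 2 :=
    (hcb.tendsto 0).eventually_lt_const (by simpa [hb0] using half_pos hε)
  obtain ⟨δ, hδ, hδs⟩ := (nhds_bot_basis (α := ℝ≥0)).eventually_iff.1 hnear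
  obtain ⟨K, hK⟩ := (isCompact_Icc (a := 0) (b := t)).bddAbove_image hcb.continuousOn
  have hδ' : (0 : ℝ) < δ := hδ
  filter_upwards [θ.tendsto_μ_zero.eventually_ge_atTop (|K| / δ), self_mem_nhdsWithin]
    with x hx hx0
  have hx0' : (x : ℝ≥0∞) ≠ 0 := by exact_mod_cast hx0
  refine lt_of_le_of_lt (runningMax_le fun s hs => ?_) (half_lt_self hε)
  rw [coupledPath_of_ne hx0']
  have hμ := mul_nonneg (θ.μ_pos x).le s.2
  by_cases hsδ : s < δ
  · have := hδs hsδ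
    have h3 : 0 ≤ θ.μ x * (s : ℝ) := hμ
    linarith
  · have h1 : θ.σ * b s ≤ K := hK ⟨s, ⟨zero_le, hs⟩, rfl⟩
    have h2 : (δ : ℝ) ≤ s := by exact_mod_cast not_lt.1 hsδ
    have h3 : |K| ≤ θ.μ x * s := by
      rw [div_le_iff₀ hδ'] at hx
      exact hx.trans (mul_le_mul_of_nonneg_left h2 (θ.μ_pos x).le)
    linarith [le_abs_self K]

/-! ### Initial paths -/

/-- The almost sure properties of the paths of a finite initial condition. -/
structure IsInitialPath (w : ℝ≥0 → ℝ) : Prop where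
  cont : Continuous w
  mono : Monotone w
  zero : w 0 = 0
  bdd : BddAbove (Set.range w)
  dyadic : dyadicSum w < ⊤

lemma valueAtInfty_eq_iSup (hw : Monotone w) : valueAtInfty w = ⨆ a, ENNReal.ofReal (w a) :=
  (tendsto_atTop_iSup fun _ _ h => ENNReal.ofReal_le_ofReal (hw h)).limUnder_eq

lemma IsInitialPath.nonneg (h : IsInitialPath w) (a : ℝ≥0) : 0 ≤ w a := h.zero ▸ h.mono zero_le

lemma IsInitialPath.extendInfty_top (h : IsInitialPath w) : extendInfty w ⊤ = ⨆ a, w a := by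
  have : Tendsto (fun a => ENNReal.ofReal (w a)) atTop (𝓝 (ENNReal.ofReal (⨆ a, w a))) :=
    ENNReal.tendsto_ofReal (tendsto_atTop_ciSup h.mono h.bdd)
  rw [extendInfty, if_pos rfl, valueAtInfty, this.limUnder_eq,
    ENNReal.toReal_ofReal (Real.iSup_nonneg h.nonneg)]

lemma extendInfty_coe (w : ℝ≥0 → ℝ) (a : ℝ≥0) : extendInfty w a = w a := by simp [extendInfty]

lemma IsInitialPath.tendsto_extendInfty (h : IsInitialPath w) :
    Tendsto (fun a : ℝ≥0 => extendInfty w a) atTop (𝓝 (extendInfty w ⊤)) := by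
  simp only [extendInfty_coe, h.extendInfty_top]
  exact tendsto_atTop_ciSup h.mono h.bdd

lemma IsInitialPath.extendInfty_mono (h : IsInitialPath w) : Monotone (extendInfty w) := by
  intro a a' haa
  induction a' with
  | top =>
    induction a with
    | top => exact le_rfl
    | coe a => rw [h.extendInfty_top, extendInfty_coe]; exact le_ciSup h.bdd a
  | coe a' =>
    lift a to ℝ≥0 using ne_top_of_le_ne_top ENNReal.coe_ne_top haa
    rw [extendInfty_coe, extendInfty_coe]
    exact h.mono (by exact_mod_cast haa)

lemma isInitialPath_of_valueAtInfty_lt_top (hc : Continuous w) (hm : Monotone w) (h0 : w 0 = 0)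
    (hv : valueAtInfty w < ⊤) (hD : dyadicSum w < ⊤) : IsInitialPath w where
  cont := hc
  mono := hm
  zero := h0
  bdd := by
    refine ⟨(valueAtInfty w).toReal, ?_⟩
    rintro _ ⟨a, rfl⟩
    rw [← ENNReal.ofReal_le_iff_le_toReal hv.ne, valueAtInfty_eq_iSup hm]
    exact le_iSup (fun a => ENNReal.ofReal (w a)) a
  dyadic := hD

lemma isInitialPath_zero : IsInitialPath fun _ => 0 where
  cont := continuous_const
  mono := monotone_const
  zero := rfl
  bdd := ⟨0, by rintro _ ⟨a, rfl⟩; exact le_rfl⟩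
  dyadic := by simp [dyadicSum]

/-! ### The dual path -/

lemma dualPath_nonneg (hb : Continuous b) (hb0 : b 0 = 0) (a : ℝ≥0∞) :
    0 ≤ dualPath θ b w t a := (runningMax_nonneg hb hb0 a).trans (le_max_right _ _)

lemma dualPath_zero_right (hw : w 0 = 0) : dualPath θ b w t 0 = 0 := by
  rw [dualPath, runningMax_zero_right, coupledPath_zero_right, ← ENNReal.coe_zero,
    extendInfty_coe, hw]
  simp

lemma dualPath_mono (hb : Continuous b) (hb0 : b 0 = 0) (hw : IsInitialPath w) :
    Monotone (dualPath θ b w t) := by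
  intro a a' h
  by_cases ha : a = 0
  · rw [ha, dualPath_zero_right hw.zero]
    exact dualPath_nonneg hb hb0 a'
  · exact max_le_max (add_le_add (hw.extendInfty_mono h) (coupledPath_mono ha h t))
      (runningMax_mono hb hb0 h)

lemma dualPath_le (hb : Continuous b) (hw : IsInitialPath w) (a : ℝ≥0) :
    dualPath θ b w t a ≤ w a + runningMax θ b t a := by
  rw [dualPath, extendInfty_coe]
  exact max_le (by gcongr; exact coupledPath_le_runningMax hb le_rfl a)
    (by linarith [hw.nonneg a])

lemma tendsto_dualPath_of_tendsto (hb : Continuous b) {l : Filter ℝ≥0} {a : ℝ≥0∞} (ha : a ≠ 0)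
    (hl : ∀ᶠ x : ℝ≥0 in l, x ≠ 0) (h : Tendsto (fun x : ℝ≥0 => θ.μ x) l (𝓝 (θ.μ a)))
    (hw : Tendsto (fun x : ℝ≥0 => extendInfty w x) l (𝓝 (extendInfty w a))) :
    Tendsto (fun x : ℝ≥0 => dualPath θ b w t x) l (𝓝 (dualPath θ b w t a)) := by
  refine (hw.add ?_).max (tendsto_runningMax_of_tendsto_μ hb ha hl h)
  rw [coupledPath_of_ne ha]
  refine (tendsto_const_nhds.sub (h.mul_const _)).congr' ?_
  filter_upwards [hl] with x hx
  rw [coupledPath_of_ne (by exact_mod_cast hx)]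

lemma continuous_dualPath (hb : Continuous b) (hb0 : b 0 = 0) (hw : IsInitialPath w) :
    Continuous fun x : ℝ≥0 => dualPath θ b w t x := by
  rw [continuous_iff_continuousAt]
  intro x
  by_cases hx : x = 0
  · subst hx
    have hlim : Tendsto (fun x : ℝ≥0 => w x + runningMax θ b t x) (𝓝 0) (𝓝 0) := by
      simpa using (hw.cont.tendsto' 0 0 hw.zero).add (tendsto_runningMax_zero (θ := θ) hb hb0)
    have : dualPath θ b w t ((0 : ℝ≥0) : ℝ≥0∞) = 0 := dualPath_zero_right hw.zero
    rw [ContinuousAt, this]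
    exact squeeze_zero (fun x => dualPath_nonneg hb hb0 _) (fun x => dualPath_le hb hw x) hlim
  · refine tendsto_dualPath_of_tendsto hb (by exact_mod_cast hx) (eventually_ne_nhds hx)
      (θ.continuousAt_μ hx) ?_
    simp only [extendInfty_coe]
    exact hw.cont.tendsto x

lemma tendsto_dualPath_atTop (hb : Continuous b) (hw : IsInitialPath w) :
    Tendsto (fun x : ℝ≥0 => dualPath θ b w t x) atTop (𝓝 (dualPath θ b w t ⊤)) :=
  tendsto_dualPath_of_tendsto hb (by simp) (eventually_ne_atTop 0) θ.tendsto_μ_atTop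
    hw.tendsto_extendInfty

lemma isLUB_dualPath (hb : Continuous b) (hb0 : b 0 = 0) (hw : IsInitialPath w) :
    IsLUB (Set.range fun x : ℝ≥0 => dualPath θ b w t x) (dualPath θ b w t ⊤) :=
  isLUB_of_tendsto_atTop (fun _ _ h => dualPath_mono hb hb0 hw (by exact_mod_cast h))
    (tendsto_dualPath_atTop hb hw)

lemma dyadicSum_dualPath_lt_top (hb : Continuous b) (hw : IsInitialPath w)
    (hD : dyadicSum (fun a => runningMax θ b t a) < ⊤) :
    dyadicSum (fun a => dualPath θ b w t a) < ⊤ :=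
  (dyadicSum_mono (dualPath_le hb hw)).trans_lt
    ((dyadicSum_add_le _ _).trans_lt (ENNReal.add_lt_top.2 ⟨hw.dyadic, hD⟩))

lemma isStateOf_stateOf {g : ℝ≥0∞ → ℝ} (h : ∃ s, IsStateOf g s) : IsStateOf g (stateOf g) := by
  rw [stateOf, dif_pos h]
  exact h.choose_spec

lemma isStateOf_dualPath (hb : Continuous b) (hb0 : b 0 = 0) (hw : IsInitialPath w)
    (hD : dyadicSum (fun a => runningMax θ b t a) < ⊤) :
    IsStateOf (dualPath θ b w t) (stateOf (dualPath θ b w t)) := by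
  apply isStateOf_stateOf
  obtain ⟨ζ, hζ⟩ := exists_isQueueMeasure (f := fun a => dualPath θ b w t a)
    (fun _ _ h => dualPath_mono hb hb0 hw (by exact_mod_cast h)) (continuous_dualPath hb hb0 hw)
    (dualPath_zero_right hw.zero) (fun a => (isLUB_dualPath hb hb0 hw).1 ⟨a, rfl⟩)
    (dyadicSum_dualPath_lt_top hb hw hD)
  exact ⟨(⟨_, continuous_dualPath hb hb0 hw⟩, ⟨_, dualPath_nonneg hb hb0 ⊤⟩, ζ),
    fun _ => rfl, rfl, hζ⟩

lemma isConsistent_of_isStateOf_dualPath (hb : Continuous b) (hb0 : b 0 = 0)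
    (hw : IsInitialPath w) {s : State} (hs : IsStateOf (dualPath θ b w t) s) :
    IsConsistent s := by
  have h1 : (s.1 : ℝ≥0 → ℝ) = fun a : ℝ≥0 => dualPath θ b w t a := funext hs.workload
  refine ⟨?_, ?_, ?_⟩
  · rw [h1]; exact fun _ _ h => dualPath_mono hb hb0 hw (by exact_mod_cast h)
  · rw [h1, hs.total]; exact isLUB_dualPath hb hb0 hw
  · rw [h1]; exact hs.queue

/-! ### Time reversal -/

lemma reversePath_self (hb0 : b 0 = 0) : reversePath b t t = b t := by
  simp [reversePath, hb0]

lemma continuous_reversePath (hb : Continuous b) (hb0 : b 0 = 0) :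
    Continuous (reversePath b t) := by
  refine Continuous.if_le (by fun_prop) hb continuous_id continuous_const ?_
  rintro s rfl
  simp [hb0]

/-- Reflecting a path is the same as taking the maximum of the reversed path. -/
lemma reflectedPath_eq_dualPath (hb : Continuous b) (hb0 : b 0 = 0) (hw : w 0 = 0) :
    reflectedPath θ.σ θ.μ b w t = dualPath θ (reversePath b t) w t := by
  funext a
  by_cases ha : a = 0
  · subst ha
    rw [dualPath_zero_right hw]
    have : extendInfty w 0 = 0 := by rw [← ENNReal.coe_zero, extendInfty_coe, hw]
    simp only [reflectedPath, skorokhodMap, coupledPath_zero_right, this, add_zero]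
    rw [Set.Nonempty.image_const ⟨0, by simp⟩]
    simp
  · set χ : ℝ≥0 → ℝ := fun s => extendInfty w a + coupledPath θ.σ θ.μ b s a with hχ
    have hχc : Continuous χ := continuous_const.add (continuous_coupledPath hb a)
    have hbdd : BddBelow (χ '' Set.Icc 0 t) := isCompact_Icc.bddBelow_image hχc.continuousOn
    have hr : Continuous (reversePath b t) := continuous_reversePath hb hb0
    have hrev : ∀ s ≤ t, coupledPath θ.σ θ.μ (reversePath b t) s a = χ t - χ (t - s) := by
      intro s hs
      simp only [hχ, coupledPath_of_ne ha, reversePath, hs, if_true, NNReal.coe_sub hs]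
      ring
    have hmax : runningMax θ (reversePath b t) t a = χ t - sInf (χ '' Set.Icc 0 t) := by
      apply le_antisymm
      · refine runningMax_le fun s hs => ?_
        rw [hrev s hs]
        have := csInf_le hbdd ⟨t - s, ⟨zero_le, tsub_le_self⟩, rfl⟩
        linarith
      · rw [sub_le_comm]
        refine le_csInf (Set.Nonempty.image _ ⟨0, by simp⟩) ?_
        rintro _ ⟨s, hs, rfl⟩
        have h1 := coupledPath_le_runningMax (θ := θ) (t := t) hr (s := t - s) tsub_le_self a
        rw [hrev _ tsub_le_self, tsub_tsub_cancel_of_le hs.2] at h1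
        linarith
    have ht : extendInfty w a + coupledPath θ.σ θ.μ (reversePath b t) t a = χ t := by
      simp only [hχ, coupledPath_of_ne ha, reversePath_self hb0]
    rw [dualPath, ht, hmax]
    change χ t - min (sInf (χ '' Set.Icc 0 t)) 0 = _
    rw [← max_sub_sub_left, sub_zero, max_comm]

/-! ### The maximum over all times -/

/-- The almost sure properties of Brownian paths. -/
structure IsDrivingPath (θ : Params) (b : ℝ≥0 → ℝ) : Prop where
  cont : Continuous b
  zero : b 0 = 0
  drift : Tendsto (fun t : ℝ≥0 => θ.σ * b t - θ.κ * t) atTop atBot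
  dyadic : dyadicSum (fun a => maxPath θ.σ θ.μ b a) < ⊤

lemma coupledPath_le_of_ne {a : ℝ≥0∞} (ha : a ≠ 0) (s : ℝ≥0) :
    coupledPath θ.σ θ.μ b s a ≤ θ.σ * b s - θ.κ * s := by
  rw [coupledPath_of_ne ha]
  have := mul_le_mul_of_nonneg_right (θ.κ_le_μ a) s.2
  exact sub_le_sub_left this _

/-- After a finite time, the dual path is equal to the maximum over all times. -/
lemma isLUB_coupledPath_dualPath (hb : Continuous b) (hb0 : b 0 = 0) (hw : IsInitialPath w)
    (h1 : ∀ s ≥ t, θ.σ * b s - θ.κ * s ≤ 0)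
    (h2 : extendInfty w ⊤ + (θ.σ * b t - θ.κ * t) ≤ 0) (a : ℝ≥0∞) :
    IsLUB (Set.range fun s => coupledPath θ.σ θ.μ b s a) (dualPath θ b w t a) := by
  by_cases ha : a = 0
  · subst ha
    rw [dualPath_zero_right hw.zero]
    simp only [coupledPath_zero_right, Set.range_const, isLUB_singleton]
  have hd : dualPath θ b w t a = runningMax θ b t a := by
    refine max_eq_right (le_trans ?_ (runningMax_nonneg hb hb0 a))
    have := coupledPath_le_of_ne (θ := θ) (b := b) ha t
    have := hw.extendInfty_mono (le_top (a := a))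
    linarith
  rw [hd]
  refine ⟨?_, fun c hc => runningMax_le fun s _ => hc ⟨s, rfl⟩⟩
  rintro _ ⟨s, rfl⟩
  rcases le_total s t with hs | hs
  · exact coupledPath_le_runningMax hb hs a
  · exact ((coupledPath_le_of_ne ha s).trans (h1 s hs)).trans (runningMax_nonneg hb hb0 a)

lemma maxPath_eq_of_isLUB {a : ℝ≥0∞} {c : ℝ}
    (h : IsLUB (Set.range fun s => coupledPath θ.σ θ.μ b s a) c) : maxPath θ.σ θ.μ b a = c :=
  h.csSup_eq (Set.range_nonempty _)

lemma eventually_isLUB_dualPath (hb : Continuous b) (hb0 : b 0 = 0)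
    (hdrift : Tendsto (fun t : ℝ≥0 => θ.σ * b t - θ.κ * t) atTop atBot) (hw : IsInitialPath w) :
    ∀ᶠ t in atTop, ∀ a, IsLUB (Set.range fun s => coupledPath θ.σ θ.μ b s a)
      (dualPath θ b w t a) := by
  have h1 := eventually_forall_ge_atTop.2 (hdrift.eventually_le_atBot 0)
  filter_upwards [h1, hdrift.eventually_le_atBot (-extendInfty w ⊤)] with t ht1 ht2
  exact isLUB_coupledPath_dualPath hb hb0 hw ht1 (by linarith)

lemma eventually_maxPath_eq_dualPath (hb : IsDrivingPath θ b) (hw : IsInitialPath w) :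
    ∀ᶠ t in atTop, maxPath θ.σ θ.μ b = dualPath θ b w t := by
  filter_upwards [eventually_isLUB_dualPath hb.cont hb.zero hb.drift hw] with t ht
  exact funext fun a => maxPath_eq_of_isLUB (ht a)

lemma bddAbove_coupledPath (hb : Continuous b) (hb0 : b 0 = 0)
    (hdrift : Tendsto (fun t : ℝ≥0 => θ.σ * b t - θ.κ * t) atTop atBot) (a : ℝ≥0∞) :
    BddAbove (Set.range fun s => coupledPath θ.σ θ.μ b s a) :=
  let ⟨_, ht⟩ := (eventually_isLUB_dualPath hb hb0 hdrift isInitialPath_zero).exists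
  ⟨_, (ht a).1⟩

lemma IsDrivingPath.bddAbove (hb : IsDrivingPath θ b) (a : ℝ≥0∞) :
    BddAbove (Set.range fun s => coupledPath θ.σ θ.μ b s a) :=
  bddAbove_coupledPath hb.cont hb.zero hb.drift a

lemma IsDrivingPath.coupledPath_le_maxPath (hb : IsDrivingPath θ b) (s : ℝ≥0) (a : ℝ≥0∞) :
    coupledPath θ.σ θ.μ b s a ≤ maxPath θ.σ θ.μ b a := le_ciSup (hb.bddAbove a) s

lemma IsDrivingPath.runningMax_dyadic (hb : IsDrivingPath θ b) (t : ℝ≥0) :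
    dyadicSum (fun a => runningMax θ b t a) < ⊤ :=
  (dyadicSum_mono fun _ => runningMax_le fun s _ =>
    hb.coupledPath_le_maxPath s _).trans_lt hb.dyadic

lemma IsDrivingPath.isStateOf_dualPath (hb : IsDrivingPath θ b) (hw : IsInitialPath w) (t : ℝ≥0) :
    IsStateOf (dualPath θ b w t) (stateOf (dualPath θ b w t)) :=
  SRPT.isStateOf_dualPath hb.cont hb.zero hw (hb.runningMax_dyadic t)

lemma IsDrivingPath.isConsistent_dualPath (hb : IsDrivingPath θ b) (hw : IsInitialPath w)
    (t : ℝ≥0) : IsConsistent (stateOf (dualPath θ b w t)) :=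
  isConsistent_of_isStateOf_dualPath hb.cont hb.zero hw (hb.isStateOf_dualPath hw t)

lemma IsDrivingPath.exists_maxPath_eq (hb : IsDrivingPath θ b) :
    ∃ t, maxPath θ.σ θ.μ b = dualPath θ b (fun _ => 0) t :=
  (eventually_maxPath_eq_dualPath hb isInitialPath_zero).exists

lemma IsDrivingPath.isStateOf_maxPath (hb : IsDrivingPath θ b) :
    IsStateOf (maxPath θ.σ θ.μ b) (stateOf (maxPath θ.σ θ.μ b)) := by
  obtain ⟨t, ht⟩ := hb.exists_maxPath_eq
  rw [ht]
  exact hb.isStateOf_dualPath isInitialPath_zero t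

lemma IsDrivingPath.isConsistent_maxPath (hb : IsDrivingPath θ b) :
    IsConsistent (stateOf (maxPath θ.σ θ.μ b)) := by
  obtain ⟨t, ht⟩ := hb.exists_maxPath_eq
  rw [ht]
  exact hb.isConsistent_dualPath isInitialPath_zero t

lemma IsDrivingPath.isInitialPath_maxPath (hb : IsDrivingPath θ b) :
    IsInitialPath fun a : ℝ≥0 => maxPath θ.σ θ.μ b a := by
  obtain ⟨t, ht⟩ := hb.exists_maxPath_eq
  refine ⟨?_, ?_, ?_, ?_, hb.dyadic⟩
  · rw [ht]; exact continuous_dualPath hb.cont hb.zero isInitialPath_zero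
  · rw [ht]
    exact fun _ _ h => dualPath_mono hb.cont hb.zero isInitialPath_zero (by exact_mod_cast h)
  · rw [ht]; exact dualPath_zero_right rfl
  · rw [ht]; exact ⟨_, (isLUB_dualPath hb.cont hb.zero isInitialPath_zero).1⟩

lemma IsDrivingPath.extendInfty_maxPath (hb : IsDrivingPath θ b) :
    extendInfty (fun a : ℝ≥0 => maxPath θ.σ θ.μ b a) = maxPath θ.σ θ.μ b := by
  obtain ⟨t, ht⟩ := hb.exists_maxPath_eq
  funext a
  induction a with
  | top =>
    rw [hb.isInitialPath_maxPath.extendInfty_top, ht]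
    exact (isLUB_dualPath hb.cont hb.zero isInitialPath_zero).csSup_eq (Set.range_nonempty _)
  | coe a => rw [extendInfty_coe]

/-- The dual path started from the maximum of the shifted path is the maximum of the path. -/
lemma dualPath_maxPath_shift (hb : IsDrivingPath θ b)
    (hs : IsDrivingPath θ fun s => b (t + s) - b t) :
    dualPath θ b (fun a : ℝ≥0 => maxPath θ.σ θ.μ (fun s => b (t + s) - b t) a) t =
      maxPath θ.σ θ.μ b := by
  funext a
  have hshift : ∀ s, coupledPath θ.σ θ.μ (fun s => b (t + s) - b t) s a +
      coupledPath θ.σ θ.μ b t a = coupledPath θ.σ θ.μ b (t + s) a := by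
    intro s
    by_cases ha : a = 0
    · simp [coupledPath, ha]
    · simp only [coupledPath_of_ne ha, NNReal.coe_add]; ring
  rw [dualPath, hs.extendInfty_maxPath]
  apply le_antisymm
  · refine max_le ?_ (runningMax_le fun s _ => hb.coupledPath_le_maxPath s a)
    rw [← le_sub_iff_add_le]
    refine ciSup_le fun s => ?_
    rw [le_sub_iff_add_le, hshift]
    exact hb.coupledPath_le_maxPath _ a
  · refine ciSup_le fun s => ?_
    rcases le_total s t with hst | hst
    · exact (coupledPath_le_runningMax hb.cont hst a).trans (le_max_right _ _)
    · refine le_trans ?_ (le_max_left _ _)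
      rw [← add_tsub_cancel_of_le hst, ← hshift]
      gcongr
      exact hs.coupledPath_le_maxPath _ a

end Paths

/-! ### Brownian motion -/

section Brownian

variable {Ω Ω' : Type*} [MeasurableSpace Ω] [MeasurableSpace Ω'] {P : Measure Ω} {P' : Measure Ω'}
  {B : ℝ≥0 → Ω → ℝ} {B' : ℝ≥0 → Ω' → ℝ}

lemma aemeasurable_brownian_sample {ι : Type*} [Countable ι] (hB : IsPreBrownianReal B P)
    (τ : ι → ℝ≥0) : AEMeasurable (fun ω i => B (τ i) ω) P :=
  aemeasurable_pi_lambda _ fun i => hB.aemeasurable (τ i)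

/-- Two Brownian motions have the same law on countably many times. -/
lemma map_brownian_sample_eq {ι : Type*} [Countable ι] (hB : IsPreBrownianReal B P)
    (hB' : IsPreBrownianReal B' P') (τ : ι → ℝ≥0) :
    P.map (fun ω i => B (τ i) ω) = P'.map (fun ω i => B' (τ i) ω) := by
  classical
  have := hB.isGaussianProcess.isProbabilityMeasure
  have := hB'.isGaussianProcess.isProbabilityMeasure
  have h1 := isProjectiveLimit_map (aemeasurable_brownian_sample hB τ)
  have h2 := isProjectiveLimit_map (aemeasurable_brownian_sample hB' τ)
  have hI : ∀ I : Finset ι, P.map (fun ω => I.restrict fun i => B (τ i) ω) =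
      P'.map (fun ω => I.restrict fun i => B' (τ i) ω) := by
    intro I
    let F : (I.image τ → ℝ) → (I → ℝ) := fun x i => x ⟨τ i, Finset.mem_image_of_mem τ i.2⟩
    have hF : Measurable F := by fun_prop
    have e1 := (hB.hasLaw (I.image τ)).map_eq
    have e2 := (hB'.hasLaw (I.image τ)).map_eq
    have := congrArg (Measure.map F) (e1.trans e2.symm)
    rwa [AEMeasurable.map_map_of_aemeasurable hF.aemeasurable (hB.hasLaw _).aemeasurable,
      AEMeasurable.map_map_of_aemeasurable hF.aemeasurable (hB'.hasLaw _).aemeasurable] at this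
  refine h1.unique ?_
  intro I
  rw [h2 I]
  exact (hI I).symm

lemma memLp_brownian (hB : IsPreBrownianReal B P) (t : ℝ≥0) : MemLp (B t) 2 P :=
  (hB.isGaussianProcess.hasGaussianLaw_eval t).memLp_two

/-- Brownian motion reversed on `[0, t]` is a Brownian motion. -/
lemma isBrownianReal_reversePath (hB : IsBrownianReal B P) (t : ℝ≥0) :
    IsBrownianReal (fun s ω => reversePath (fun u => B u ω) t s) P where
  toIsPreBrownianReal := by
    have := hB.isGaussianProcess.isProbabilityMeasure
    have hle : ∀ s ≤ t, (fun ω => reversePath (fun u => B u ω) t s) =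
        fun ω => B t ω - B (t - s) ω := fun s hs => by funext ω; simp [reversePath, hs]
    have hgt : ∀ s, ¬ s ≤ t → (fun ω => reversePath (fun u => B u ω) t s) = B s :=
      fun s hs => by funext ω; simp [reversePath, hs]
    have hL := memLp_brownian hB.toIsPreBrownianReal
    refine IsGaussianProcess.isPreBrownianReal_of_covariance ?_ (fun s => ?_) (fun s u hsu => ?_)
    · refine hB.isGaussianProcess.of_isGaussianProcess fun s => ?_
      by_cases hs : s ≤ t
      · exact ⟨{t, t - s},
          { toFun x := x ⟨t, by simp⟩ - x ⟨t - s, by simp⟩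
            map_add' x y := by simp; abel
            map_smul' c x := by simp; ring }, by simp [reversePath, hs]⟩
      · exact ⟨{s},
          { toFun x := x ⟨s, by simp⟩
            map_add' x y := by simp
            map_smul' c x := by simp }, by simp [reversePath, hs]⟩
    · by_cases hs : s ≤ t
      · rw [hle s hs, integral_sub (hB.integrable_eval _) (hB.integrable_eval _),
          hB.integral_eval, hB.integral_eval, sub_zero]
      · rw [hgt s hs, hB.integral_eval]
    · by_cases hu : u ≤ t
      · rw [hle s (hsu.trans hu), hle u hu, covariance_fun_sub_fun_sub (hL _) (hL _) (hL _) (hL _)]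
        simp only [hB.covariance_eval]
        rw [min_self, min_eq_right tsub_le_self, min_eq_left tsub_le_self,
          min_eq_right (tsub_le_tsub_left hsu t), NNReal.coe_sub (hsu.trans hu), NNReal.coe_sub hu]
        ring
      · by_cases hs : s ≤ t
        · have htu : t ≤ u := (not_le.1 hu).le
          rw [hle s hs, hgt u hu, covariance_fun_sub_left (hL _) (hL _) (hL _),
            hB.covariance_eval, hB.covariance_eval, min_eq_left htu,
            min_eq_left (tsub_le_self.trans htu), NNReal.coe_sub hs]
          ring
        · rw [hgt s hs, hgt u hu, hB.covariance_eval, min_eq_left hsu]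
  cont := by
    filter_upwards [hB.cont, hB.eval_zero_ae_eq_zero] with ω h h0
    exact continuous_reversePath h h0

/-! ### The maximum of Brownian motion with negative drift -/

lemma lintegral_exp_brownian [IsProbabilityMeasure P] (hB : IsPreBrownianReal B P) {σ m : ℝ}
    (hσ : 0 < σ) (h : ℝ≥0) :
    ∫⁻ ω, ENNReal.ofReal (Real.exp (2 * m / σ ^ 2 * (σ * B h ω - m * h))) ∂P = 1 := by
  have hlaw := hB.hasLaw_eval h
  have hmgf := mgf_gaussianReal hlaw.map_eq (2 * m / σ)
  have hexp : Integrable (fun ω => Real.exp (2 * m / σ * B h ω)) P := by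
    have := integrable_exp_mul_gaussianReal (μ := 0) (v := h) (2 * m / σ)
    rw [← hlaw.map_eq] at this
    exact this.comp_aemeasurable hlaw.aemeasurable
  have heq : ∀ ω, Real.exp (2 * m / σ ^ 2 * (σ * B h ω - m * h)) =
      Real.exp (-(2 * m ^ 2 / σ ^ 2 * h)) * Real.exp (2 * m / σ * B h ω) := fun ω => by
    rw [← Real.exp_add]
    congr 1
    field_simp
    ring
  simp_rw [heq]
  rw [← ofReal_integral_eq_lintegral_ofReal (hexp.const_mul _)
    (ae_of_all _ fun ω => by positivity), integral_const_mul]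
  change ENNReal.ofReal (_ * mgf (B h) P (2 * m / σ)) = 1
  rw [hmgf, ← Real.exp_add, ← ENNReal.ofReal_one]
  congr 1
  rw [Real.exp_eq_one_iff]
  field_simp
  ring

/-- The maximal inequality on a grid of times. -/
lemma measure_exists_grid_le {σ m : ℝ} (hσ : 0 < σ) (hm : 0 < m) (h : ℝ≥0) (n : ℕ)
    [IsProbabilityMeasure P] (hB : IsPreBrownianReal B P) (x : ℝ) :
    P {ω | ∃ k : ℕ, 1 ≤ k ∧ k ≤ n ∧ x ≤ σ * B (k * h) ω - m * (k * h)} ≤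
      ENNReal.ofReal (Real.exp (-(2 * m / σ ^ 2) * x)) := by
  induction n generalizing B x with
  | zero =>
    have : {ω | ∃ k : ℕ, 1 ≤ k ∧ k ≤ 0 ∧ x ≤ σ * B (k * h) ω - m * (k * h)} = ∅ := by
      ext ω
      simp only [Set.mem_ofPred_eq, Set.mem_empty_iff_false, iff_false]
      rintro ⟨k, h1, h2, _⟩
      omega
    rw [this]
    simp
  | succ n ih =>
    have hα : 0 < 2 * m / σ ^ 2 := by positivity
    set α := 2 * m / σ ^ 2 with hαdef
    let ξ : Ω → ℝ := fun ω => σ * B h ω - m * h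
    let V : Ω → ℕ → ℝ := fun ω k => σ * (B (h + k * h) ω - B h ω) - m * (k * h)
    have hshift := hB.shift h
    have hξ : AEMeasurable ξ P := ((hB.aemeasurable h).const_mul σ).sub_const _
    have hV : AEMeasurable V P := aemeasurable_pi_lambda _ fun k =>
      ((hshift.aemeasurable (k * h)).const_mul σ).sub_const _
    have hind : IndepFun ξ V P := by
      have := hB.indepFun_shift h
      have h2 := this.comp
        (φ := fun (y : ℝ≥0 → ℝ) (k : ℕ) => σ * y (k * h) - m * (k * h))
        (ψ := fun y : Set.Iic h → ℝ => σ * y ⟨h, le_refl h⟩ - m * h)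
        (by fun_prop) (by fun_prop)
      exact h2.symm
    let E : Set (ℝ × (ℕ → ℝ)) :=
      {q | x ≤ q.1} ∪ ⋃ k : ℕ, ⋃ (_ : 1 ≤ k ∧ k ≤ n), {q | x - q.1 ≤ q.2 k}
    have hE : MeasurableSet E := by
      refine (measurableSet_le (by fun_prop) (by fun_prop)).union
        (MeasurableSet.iUnion fun k => MeasurableSet.iUnion fun _ =>
          measurableSet_le (by fun_prop) (by fun_prop))
    have hsub : {ω | ∃ k : ℕ, 1 ≤ k ∧ k ≤ n + 1 ∧ x ≤ σ * B (k * h) ω - m * (k * h)} ⊆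
        (fun ω => (ξ ω, V ω)) ⁻¹' E := by
      rintro ω ⟨k, h1, h2, h3⟩
      obtain ⟨j, rfl⟩ : ∃ j, k = j + 1 := ⟨k - 1, by omega⟩
      rcases Nat.eq_zero_or_pos j with rfl | hj
      · left
        simpa [ξ] using h3
      · right
        simp only [Set.mem_iUnion]
        refine ⟨j, ⟨hj, by omega⟩, ?_⟩
        have hjh : ((j + 1 : ℕ) : ℝ≥0) * h = h + j * h := by push_cast; ring
        rw [hjh] at h3
        have : x - ξ ω ≤ V ω j := by
          simp only [ξ, V]
          push_cast at h3
          linarith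
        exact this
    refine (measure_mono hsub).trans ?_
    rw [← Measure.map_apply_of_aemeasurable (hξ.prodMk hV) hE,
      (indepFun_iff_map_prod_eq_prod_map_map hξ hV).1 hind, Measure.prod_apply hE]
    have := Measure.isProbabilityMeasure_map hV
    have hbound : ∀ y, (P.map V) (Prod.mk y ⁻¹' E) ≤
        ENNReal.ofReal (Real.exp (-α * x)) * ENNReal.ofReal (Real.exp (α * y)) := by
      intro y
      rw [← ENNReal.ofReal_mul (Real.exp_pos _).le, ← Real.exp_add]
      rcases le_or_gt x y with hxy | hxy
      · refine prob_le_one.trans ?_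
        rw [← ENNReal.ofReal_one]
        refine ENNReal.ofReal_le_ofReal (Real.one_le_exp ?_)
        nlinarith
      · rw [Measure.map_apply_of_aemeasurable hV (measurable_prodMk_left hE)]
        have := ih hshift (x - y)
        rw [show -α * x + α * y = -α * (x - y) by ring]
        refine le_trans (measure_mono ?_) this
        rintro ω (hω | hω)
        · exact absurd hω (not_le.2 hxy)
        · simp only [Set.mem_iUnion] at hω
          obtain ⟨k, ⟨h1, h2⟩, h3⟩ := hω
          exact ⟨k, h1, h2, h3⟩
    refine (lintegral_mono hbound).trans ?_
    rw [lintegral_const_mul _ (by fun_prop), lintegral_map' (by fun_prop) hξ]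
    rw [lintegral_exp_brownian hB hσ h, mul_one]

/-- The maximal inequality for Brownian motion with negative drift. -/
lemma measure_exists_lt_le [IsProbabilityMeasure P] (hB : IsBrownianReal B P) {σ m : ℝ}
    (hσ : 0 < σ) (hm : 0 < m) {x : ℝ} (hx : 0 ≤ x) :
    P {ω | ∃ t : ℝ≥0, x < σ * B t ω - m * t} ≤
      ENNReal.ofReal (Real.exp (-(2 * m / σ ^ 2) * x)) := by
  let A : ℕ → Set Ω := fun N => {ω | ∃ k : ℕ, 1 ≤ k ∧ k ≤ 4 ^ N ∧
    x ≤ σ * B (k * 2⁻¹ ^ N) ω - m * (k * (2⁻¹ ^ N : ℝ≥0))}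
  have hA : Monotone A := by
    refine monotone_nat_of_le_succ fun N => ?_
    rintro ω ⟨k, h1, h2, h3⟩
    have heq : ((2 * k : ℕ) : ℝ≥0) * 2⁻¹ ^ (N + 1) = k * 2⁻¹ ^ N := by
      rw [pow_succ]; push_cast; field_simp
    refine ⟨2 * k, by omega, by rw [pow_succ]; omega, ?_⟩
    rw [heq, ← NNReal.coe_natCast, ← NNReal.coe_mul, heq]
    simpa using h3
  have hsub : ∀ᵐ ω ∂P, ω ∈ {ω | ∃ t : ℝ≥0, x < σ * B t ω - m * t} → ω ∈ ⋃ N, A N := by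
    filter_upwards [hB.cont, hB.eval_zero_ae_eq_zero] with ω hc h0
    rintro ⟨t, ht⟩
    have hcont : Continuous fun s : ℝ≥0 => σ * B s ω - m * s := by fun_prop
    have ht0 : 0 < t := by
      rw [pos_iff_ne_zero]
      rintro rfl
      rw [h0] at ht
      simp at ht
      linarith
    let u : ℕ → ℝ≥0 := fun N => (⌊t * 2 ^ N⌋₊ : ℝ≥0) * 2⁻¹ ^ N
    have hu : Tendsto u atTop (𝓝 t) := by
      have h1 : Tendsto (fun N : ℕ => (2 : ℝ≥0) ^ N) atTop atTop :=
        tendsto_pow_atTop_atTop_of_one_lt (by norm_num)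
      have := (tendsto_nat_floor_mul_div_atTop (R := ℝ) (a := t) t.2).comp
        (NNReal.tendsto_coe_atTop.2 h1)
      rw [← NNReal.tendsto_coe]
      refine this.congr fun N => ?_
      simp only [u, Function.comp, NNReal.coe_mul, NNReal.coe_natCast, NNReal.coe_pow,
        NNReal.coe_inv, NNReal.coe_ofNat, div_eq_mul_inv, inv_pow]
      congr 2
    have h4 := ((hcont.tendsto t).comp hu).eventually_const_lt ht
    have h5 := hu.eventually_const_lt ht0
    obtain ⟨K, hK⟩ := exists_nat_ge t
    obtain ⟨N, hN1, hN2, hN3⟩ := (h4.and (h5.and (eventually_ge_atTop K))).exists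
    refine Set.mem_iUnion.2 ⟨N, ⌊t * 2 ^ N⌋₊, ?_, ?_, ?_⟩
    · rw [Nat.one_le_iff_ne_zero]
      intro h
      simp [u, h] at hN2
    · have hKN : (K : ℝ≥0) ≤ 2 ^ N := by
        have : K ≤ 2 ^ N := hN3.trans (Nat.lt_two_pow_self).le
        exact_mod_cast this
      refine Nat.floor_le_of_le ?_
      push_cast
      calc t * 2 ^ N ≤ 2 ^ N * 2 ^ N := by gcongr; exact hK.trans hKN
        _ = 4 ^ N := by rw [← mul_pow]; norm_num
    · have := hN1.le
      simpa [u] using this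
  calc P {ω | ∃ t : ℝ≥0, x < σ * B t ω - m * t} ≤ P (⋃ N, A N) := measure_mono_ae hsub
    _ = ⨆ N, P (A N) := hA.measure_iUnion
    _ ≤ _ := iSup_le fun N => measure_exists_grid_le hσ hm _ _ hB.toIsPreBrownianReal x

/-- Brownian motion with negative drift is bounded above. -/
lemma ae_bddAbove_brownian_drift [IsProbabilityMeasure P] (hB : IsBrownianReal B P) {σ m : ℝ}
    (hσ : 0 < σ) (hm : 0 < m) :
    ∀ᵐ ω ∂P, BddAbove (Set.range fun t : ℝ≥0 => σ * B t ω - m * t) := by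
  rw [ae_iff]
  have hle : ∀ n : ℕ, P {ω | ¬ BddAbove (Set.range fun t : ℝ≥0 => σ * B t ω - m * t)} ≤
      ENNReal.ofReal (Real.exp (-(2 * m / σ ^ 2) * n)) := fun n => by
    refine le_trans (measure_mono fun ω hω => ?_) (measure_exists_lt_le hB hσ hm n.cast_nonneg)
    obtain ⟨_, ⟨t, rfl⟩, ht⟩ := not_bddAbove_iff.1 hω n
    exact ⟨t, ht⟩
  have hlim : Tendsto (fun n : ℕ => ENNReal.ofReal (Real.exp (-(2 * m / σ ^ 2) * n))) atTop
      (𝓝 0) := by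
    rw [← ENNReal.ofReal_zero]
    refine ENNReal.tendsto_ofReal (Real.tendsto_exp_atBot.comp ?_)
    exact tendsto_natCast_atTop_atTop.const_mul_atTop_of_neg
      (neg_neg_of_pos (by positivity))
  exact le_antisymm (ge_of_tendsto' hlim hle) zero_le

lemma ae_tendsto_brownian_drift [IsProbabilityMeasure P] (hB : IsBrownianReal B P) {σ m : ℝ}
    (hσ : 0 < σ) (hm : 0 < m) :
    ∀ᵐ ω ∂P, Tendsto (fun t : ℝ≥0 => σ * B t ω - m * t) atTop atBot := by
  filter_upwards [ae_bddAbove_brownian_drift hB hσ (half_pos hm)] with ω ⟨C, hC⟩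
  have h1 : Tendsto (fun t : ℝ≥0 => C + -(m / 2) * t) atTop atBot :=
    tendsto_atBot_add_const_left _ _
      ((NNReal.tendsto_coe_atTop.2 tendsto_id).const_mul_atTop_of_neg (by linarith))
  refine tendsto_atBot_mono (fun t => ?_) h1
  have := hC ⟨t, rfl⟩
  dsimp only at this
  linarith

lemma ciSup_eq_ciSup_denseRange {X : Type*} [TopologicalSpace X] {f : X → ℝ} (hf : Continuous f)
    (hb : BddAbove (Set.range f)) {d : ℕ → X} (hd : DenseRange d) :
    ⨆ x, f x = ⨆ n, f (d n) := by
  have hb' : BddAbove (Set.range fun n => f (d n)) := hb.mono (Set.range_comp_subset_range d f)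
  have : Nonempty X := ⟨d 0⟩
  refine le_antisymm (ciSup_le fun x => ?_) (ciSup_le fun n => le_ciSup hb (d n))
  have hcl : IsClosed {x | f x ≤ ⨆ n, f (d n)} := isClosed_le hf continuous_const
  exact hcl.closure_subset_iff.2 (by rintro _ ⟨n, rfl⟩; exact le_ciSup hb' n) (hd x)

lemma maxPath_eq_iSup_nat {θ : Params} {b : ℝ≥0 → ℝ} (hb : Continuous b) (hb0 : b 0 = 0)
    (hdrift : Tendsto (fun t : ℝ≥0 => θ.σ * b t - θ.κ * t) atTop atBot) (a : ℝ≥0∞) :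
    maxPath θ.σ θ.μ b a =
      ⨆ n : ℕ, coupledPath θ.σ θ.μ b (TopologicalSpace.denseSeq ℝ≥0 n) a :=
  ciSup_eq_ciSup_denseRange (continuous_coupledPath hb a) (bddAbove_coupledPath hb hb0 hdrift a)
    (TopologicalSpace.denseRange_denseSeq _)

lemma aemeasurable_coupledPath (θ : Params) (hB : IsPreBrownianReal B P) (s : ℝ≥0) (a : ℝ≥0∞) :
    AEMeasurable (fun ω => coupledPath θ.σ θ.μ (fun s => B s ω) s a) P := by
  by_cases ha : a = 0
  · simp only [ha, coupledPath_zero_right]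
    exact aemeasurable_const
  · simp only [coupledPath_of_ne ha]
    exact ((hB.aemeasurable s).const_mul _).sub_const _

/-! ### Paths of finite initial conditions -/

lemma IsFiniteInitialCondition.ae_isInitialPath {w : ℝ≥0 → Ω → ℝ}
    (hw : IsFiniteInitialCondition w B P) : ∀ᵐ ω ∂P, IsInitialPath fun a => w a ω := by
  have hv : ∀ᵐ ω ∂P, valueAtInfty (fun a => w a ω) < ⊤ := by
    refine ae_lt_top' ?_ hw.at_infty.ne
    refine AEMeasurable.congr (AEMeasurable.iSup fun n : ℕ => (hw.aemeasurable n).ennreal_ofReal) ?_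
    filter_upwards [hw.paths] with ω h
    rw [valueAtInfty_eq_iSup h.2.1]
    refine le_antisymm (iSup_le fun n => le_iSup (fun a => ENNReal.ofReal (w a ω)) n)
      (iSup_le fun a => ?_)
    obtain ⟨n, hn⟩ := exists_nat_ge a
    exact (ENNReal.ofReal_le_ofReal (h.2.1 hn)).trans
      (le_iSup (fun n : ℕ => ENNReal.ofReal (w n ω)) n)
  have hD : ∀ᵐ ω ∂P, dyadicSum (fun a => w a ω) < ⊤ := by
    have hm : ∀ a, AEMeasurable (fun ω => ENNReal.ofReal (w a ω)) P :=
      fun a => (hw.aemeasurable a).ennreal_ofReal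
    refine ae_lt_top' (AEMeasurable.tsum fun n => (hm _).const_mul _) (ne_of_lt ?_)
    have h1 : ∫⁻ ω, ENNReal.ofReal (w 1 ω) ∂P < ⊤ := by
      refine (lintegral_mono_ae ?_).trans_lt hw.at_infty
      filter_upwards [hw.paths] with ω h
      rw [valueAtInfty_eq_iSup h.2.1]
      exact le_iSup (fun a => ENNReal.ofReal (w a ω)) 1
    calc ∫⁻ ω, dyadicSum (fun a => w a ω) ∂P
        ≤ ∫⁻ ω, (ENNReal.ofReal (w 1 ω) + 4 * ∫⁻ a in Set.Ioc (0 : ℝ) 1,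
            ENNReal.ofReal (w a.toNNReal ω / a ^ 2)) ∂P := by
          refine lintegral_mono_ae ?_
          filter_upwards [hw.paths] with ω h
          exact dyadicSum_le_lintegral_Ioc h.2.1 h.2.2
      _ < ⊤ := by
          rw [lintegral_add_left' (hm 1), lintegral_const_mul' _ _ (by simp)]
          exact ENNReal.add_lt_top.2 ⟨h1, ENNReal.mul_lt_top (by simp) hw.near_zero⟩
  filter_upwards [hw.paths, hv, hD] with ω h1 h2 h3
  exact isInitialPath_of_valueAtInfty_lt_top h1.1 h1.2.1 h1.2.2 h2 h3

/-! ### Paths of Brownian motion -/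

variable [IsProbabilityMeasure P] (θ : Params)

lemma ae_maxProcess_eq_iSup_nat (hB : IsBrownianReal B P) :
    ∀ᵐ ω ∂P, ∀ a, maxProcess θ B ω a =
      ⨆ n : ℕ, coupledPath θ.σ θ.μ (fun s => B s ω) (TopologicalSpace.denseSeq ℝ≥0 n) a := by
  filter_upwards [hB.cont, hB.eval_zero_ae_eq_zero, ae_tendsto_brownian_drift hB θ.σ_pos θ.κ_pos]
    with ω h1 h2 h3 a
  exact maxPath_eq_iSup_nat h1 h2 h3 a

lemma aemeasurable_maxProcess (hB : IsBrownianReal B P) (a : ℝ≥0∞) :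
    AEMeasurable (fun ω => maxProcess θ B ω a) P := by
  refine AEMeasurable.congr (AEMeasurable.iSup fun n => aemeasurable_coupledPath θ
    hB.toIsPreBrownianReal (TopologicalSpace.denseSeq ℝ≥0 n) a) ?_
  filter_upwards [ae_maxProcess_eq_iSup_nat θ hB] with ω h
  exact (h a).symm

lemma lintegral_maxProcess_le (hB : IsBrownianReal B P) {a : ℝ≥0∞} (ha : a ≠ 0) :
    ∫⁻ ω, ENNReal.ofReal (maxProcess θ B ω a) ∂P ≤ ENNReal.ofReal (θ.σ ^ 2 / (2 * θ.μ a)) := by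
  have hσ := θ.σ_pos
  have hμ := θ.μ_pos a
  have hα : 0 < 2 * θ.μ a / θ.σ ^ 2 := by positivity
  have hnn : 0 ≤ᵐ[P] fun ω => maxProcess θ B ω a := by
    filter_upwards [hB.cont, hB.eval_zero_ae_eq_zero,
      ae_tendsto_brownian_drift hB θ.σ_pos θ.κ_pos] with ω h1 h2 h3
    have := le_ciSup (bddAbove_coupledPath h1 h2 h3 a) 0
    rwa [coupledPath_zero_left h2] at this
  rw [lintegral_eq_lintegral_meas_lt P hnn (aemeasurable_maxProcess θ hB a)]
  have hbound : ∀ x ∈ Set.Ioi (0 : ℝ), P {ω | x < maxProcess θ B ω a} ≤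
      ENNReal.ofReal (Real.exp (-(2 * θ.μ a / θ.σ ^ 2) * x)) := by
    intro x hx
    refine le_trans (measure_mono fun ω hω => ?_) (measure_exists_lt_le hB hσ hμ (le_of_lt hx))
    obtain ⟨t, ht⟩ := exists_lt_of_lt_ciSup (show x < maxProcess θ B ω a from hω)
    rw [coupledPath_of_ne ha] at ht
    exact ⟨t, ht⟩
  refine (setLIntegral_mono_ae (by fun_prop) (ae_of_all _ hbound)).trans ?_
  have hneg : -(2 * θ.μ a / θ.σ ^ 2) < 0 := neg_neg_of_pos hα
  rw [← ofReal_integral_eq_lintegral_ofReal (integrableOn_exp_mul_Ioi hneg 0)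
    (ae_of_all _ fun x => (Real.exp_pos _).le), integral_exp_mul_Ioi hneg 0]
  refine ENNReal.ofReal_le_ofReal (le_of_eq ?_)
  rw [mul_zero, Real.exp_zero]
  field_simp

lemma lintegral_dyadicSum_maxProcess_lt_top (hB : IsBrownianReal B P) :
    ∫⁻ ω, dyadicSum (fun a => maxProcess θ B ω a) ∂P < ⊤ := by
  have hσ := θ.σ_pos
  have hlam := θ.lam_pos
  unfold dyadicSum
  rw [lintegral_tsum fun n =>
    ((aemeasurable_maxProcess θ hB _).ennreal_ofReal).const_mul _]
  set r : ℝ := 2 * 2⁻¹ ^ θ.p with hr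
  have hr0 : 0 ≤ r := by positivity
  have hr1 : r < 1 := by
    have h2 : (2⁻¹ : ℝ) ^ θ.p < 2⁻¹ ^ (1 : ℝ) :=
      Real.rpow_lt_rpow_of_exponent_gt (by norm_num) (by norm_num) θ.one_lt_p
    rw [Real.rpow_one] at h2
    linarith
  have hterm : ∀ n : ℕ, ∫⁻ ω, 2 ^ n * ENNReal.ofReal
      (maxProcess θ B ω ((2⁻¹ ^ n : ℝ≥0) : ℝ≥0∞)) ∂P ≤
        ENNReal.ofReal (θ.σ ^ 2 / (2 * θ.lam) * r ^ n) := by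
    intro n
    have hne : ((2⁻¹ ^ n : ℝ≥0) : ℝ≥0∞) ≠ 0 := by
      rw [Ne, ENNReal.coe_eq_zero]; positivity
    rw [lintegral_const_mul'' _ (aemeasurable_maxProcess θ hB _).ennreal_ofReal]
    refine (mul_le_mul_right (lintegral_maxProcess_le θ hB hne) _).trans ?_
    rw [show (2 : ℝ≥0∞) = ENNReal.ofReal 2 by simp, ← ENNReal.ofReal_pow (by norm_num),
      ← ENNReal.ofReal_mul (by positivity)]
    refine ENNReal.ofReal_le_ofReal ?_
    have hx : (0 : ℝ) < 2⁻¹ ^ n := by positivity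
    have hμ : θ.lam * ((2⁻¹ : ℝ) ^ n) ^ (-θ.p) ≤ θ.μ ((2⁻¹ ^ n : ℝ≥0) : ℝ≥0∞) := by
      rw [θ.μ_coe]
      push_cast
      linarith [θ.κ_pos]
    have hpos : 0 < θ.lam * ((2⁻¹ : ℝ) ^ n) ^ (-θ.p) := by positivity
    have h3 : θ.σ ^ 2 / (2 * θ.μ ((2⁻¹ ^ n : ℝ≥0) : ℝ≥0∞)) ≤
        θ.σ ^ 2 / (2 * (θ.lam * ((2⁻¹ : ℝ) ^ n) ^ (-θ.p))) := by gcongr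
    refine (mul_le_mul_of_nonneg_left h3 (by positivity)).trans (le_of_eq ?_)
    have h4 : ((2⁻¹ : ℝ) ^ n) ^ (-θ.p) = ((2⁻¹ ^ θ.p) ^ n)⁻¹ := by
      rw [Real.rpow_neg hx.le, ← Real.rpow_natCast, ← Real.rpow_natCast, ← Real.rpow_mul
        (by norm_num), ← Real.rpow_mul (by norm_num), mul_comm]
    have h5 : (0 : ℝ) < (2⁻¹ : ℝ) ^ θ.p := by positivity
    rw [h4, hr, mul_pow]
    field_simp
  refine (ENNReal.tsum_le_tsum hterm).trans_lt ?_
  exact ((summable_geometric_of_lt_one hr0 hr1).mul_left _).tsum_ofReal_lt_top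

lemma ae_isDrivingPath (hB : IsBrownianReal B P) :
    ∀ᵐ ω ∂P, IsDrivingPath θ fun s => B s ω := by
  have hD : ∀ᵐ ω ∂P, dyadicSum (fun a => maxProcess θ B ω a) < ⊤ := by
    refine ae_lt_top' ?_ (lintegral_dyadicSum_maxProcess_lt_top θ hB).ne
    exact AEMeasurable.tsum fun n =>
      ((aemeasurable_maxProcess θ hB _).ennreal_ofReal).const_mul _
  filter_upwards [hB.cont, hB.eval_zero_ae_eq_zero,
    ae_tendsto_brownian_drift hB θ.σ_pos θ.κ_pos, hD] with ω h1 h2 h3 h4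
  exact ⟨h1, h2, h3, h4⟩

end Brownian

/-! ### Laws of dual paths -/

section Sampling

/-- The dense sequence of sizes on which workloads are sampled. -/
noncomputable def sampleSize (n : ℕ) : ℝ≥0 := TopologicalSpace.denseSeq ℝ≥0 n

lemma denseRange_sampleSize : DenseRange sampleSize := TopologicalSpace.denseRange_denseSeq _

/-- The time `t`, together with a dense sequence of times in `[0, t]`. -/
noncomputable def sampleTime (t : ℝ≥0) : Option ℕ → ℝ≥0
  | none => t
  | some k => min (sampleSize k) t

/-- The dual path on a dense sequence of sizes as a function of countably many values of the
initial and the driving path. -/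
noncomputable def dualSample (θ : Params) (t : ℝ≥0) (q : (ℕ → ℝ) × (Option ℕ → ℝ)) (n : ℕ) : ℝ :=
  max (q.1 n + coupledPath θ.σ θ.μ (fun _ => q.2 none) t (sampleSize n))
    (⨆ k, coupledPath θ.σ θ.μ (fun _ => q.2 (some k)) (sampleTime t (some k)) (sampleSize n))

/-- The maximum over all times on a dense sequence of sizes as a function of countably many values
of the driving path. -/
noncomputable def maxSample (θ : Params) (v : ℕ → ℝ) (n : ℕ) : ℝ :=
  ⨆ k, coupledPath θ.σ θ.μ (fun _ => v k) (sampleSize k) (sampleSize n)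

lemma measurable_coupledPath_const {α : Type*} [MeasurableSpace α] (θ : Params) {f : α → ℝ}
    (hf : Measurable f) (s : ℝ≥0) (a : ℝ≥0∞) :
    Measurable fun x => coupledPath θ.σ θ.μ (fun _ => f x) s a := by
  by_cases ha : a = 0
  · simp only [ha, coupledPath_zero_right]
    exact measurable_const
  · simp only [coupledPath_of_ne ha]
    exact (hf.const_mul _).sub_const _

lemma measurable_dualSample (θ : Params) (t : ℝ≥0) : Measurable (dualSample θ t) := by
  refine measurable_pi_lambda _ fun n => ?_
  refine Measurable.max (((measurable_pi_apply n).comp measurable_fst).add ?_)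
    (Measurable.iSup fun k => ?_)
  · exact measurable_coupledPath_const θ ((measurable_pi_apply _).comp measurable_snd) _ _
  · exact measurable_coupledPath_const θ ((measurable_pi_apply _).comp measurable_snd) _ _

lemma measurable_maxSample (θ : Params) : Measurable (maxSample θ) :=
  measurable_pi_lambda _ fun _ => Measurable.iSup fun k =>
    measurable_coupledPath_const θ (measurable_pi_apply k) _ _

lemma runningMax_eq_iSup_nat {θ : Params} {b : ℝ≥0 → ℝ} (hb : Continuous b) (t : ℝ≥0)
    (a : ℝ≥0∞) :
    runningMax θ b t a = ⨆ k, coupledPath θ.σ θ.μ b (sampleTime t (some k)) a := by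
  have hrange : (fun s => coupledPath θ.σ θ.μ b s a) '' Set.Icc 0 t =
      Set.range fun s => coupledPath θ.σ θ.μ b (min s t) a := by
    ext y
    constructor
    · rintro ⟨s, hs, rfl⟩
      exact ⟨s, by simp only [min_eq_left hs.2]⟩
    · rintro ⟨s, rfl⟩
      exact ⟨min s t, ⟨zero_le, min_le_right _ _⟩, rfl⟩
  have hbdd := bddAbove_coupledPath_Icc (θ := θ) hb t a
  rw [hrange] at hbdd
  rw [runningMax, hrange]
  exact ciSup_eq_ciSup_denseRange ((continuous_coupledPath hb a).comp (by fun_prop)) hbdd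
    denseRange_sampleSize

lemma sample_stateOf_dualPath {θ : Params} {b w : ℝ≥0 → ℝ} (hb : IsDrivingPath θ b)
    (hw : IsInitialPath w) (t : ℝ≥0) :
    sample (stateOf (dualPath θ b w t)) =
      dualSample θ t (fun n => w (sampleSize n), fun i => b (sampleTime t i)) := by
  funext n
  rw [sample, (hb.isStateOf_dualPath hw t).workload]
  change dualPath θ b w t (sampleSize n) = _
  rw [dualPath, runningMax_eq_iSup_nat hb.cont, extendInfty_coe]
  rfl

lemma maxPath_sampleSize {θ : Params} {b : ℝ≥0 → ℝ} (hb : IsDrivingPath θ b) :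
    (fun n => maxPath θ.σ θ.μ b (sampleSize n)) = maxSample θ fun k => b (sampleSize k) := by
  funext n
  rw [maxPath_eq_iSup_nat hb.cont hb.zero hb.drift]
  rfl

lemma sample_stateOf_maxPath {θ : Params} {b : ℝ≥0 → ℝ} (hb : IsDrivingPath θ b) :
    sample (stateOf (maxPath θ.σ θ.μ b)) = fun n => maxPath θ.σ θ.μ b (sampleSize n) :=
  funext fun _ => hb.isStateOf_maxPath.workload _

end Sampling

section Laws

variable {Ω Ω' : Type*} [MeasurableSpace Ω] [MeasurableSpace Ω'] {P : Measure Ω} {P' : Measure Ω'}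
  {B w : ℝ≥0 → Ω → ℝ} {B' w' : ℝ≥0 → Ω' → ℝ} (θ : Params)

/-- The state of the dual process. -/
noncomputable def dualState (B w : ℝ≥0 → Ω → ℝ) (t : ℝ≥0) (ω : Ω) : State :=
  stateOf (dualPath θ (fun s => B s ω) (fun a => w a ω) t)

/-- The values of an initial condition on a dense sequence. -/
noncomputable def initialSample (w : ℝ≥0 → Ω → ℝ) (ω : Ω) (n : ℕ) : ℝ := w (sampleSize n) ω

lemma aemeasurable_initialSample (hw : ∀ a, AEMeasurable (w a) P) :
    AEMeasurable (initialSample w) P :=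
  aemeasurable_pi_lambda _ fun n => hw (sampleSize n)

lemma ae_workload_eq_dualPath (hB : IsBrownianReal B P) (hw : IsFiniteInitialCondition w B P)
    (t : ℝ≥0) : ∀ᵐ ω ∂P, workload θ B w t ω =
      dualPath θ (fun s => reversePath (fun u => B u ω) t s) (fun a => w a ω) t := by
  filter_upwards [hB.cont, hB.eval_zero_ae_eq_zero, hw.paths] with ω h1 h2 h3
  exact reflectedPath_eq_dualPath h1 h2 h3.2.2

lemma scalingLimit_ae_eq (hB : IsBrownianReal B P) (hw : IsFiniteInitialCondition w B P)
    (t : ℝ≥0) : scalingLimit θ B w t =ᵐ[P]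
      dualState θ (fun s ω => reversePath (fun u => B u ω) t s) w t := by
  filter_upwards [ae_workload_eq_dualPath θ hB hw t] with ω h
  rw [scalingLimit, h, dualState]

lemma indepFun_initialSample (hw : IsFiniteInitialCondition w B P) {ι : Type*}
    {F : (ℝ≥0 → ℝ) → ι → ℝ} (hF : Measurable F) :
    IndepFun (initialSample w) (fun ω => F fun s => B s ω) P :=
  hw.indep.comp (φ := fun (v : ℝ≥0 → ℝ) (n : ℕ) => v (sampleSize n)) (ψ := F) (by fun_prop) hF

variable [IsProbabilityMeasure P] [IsProbabilityMeasure P']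

lemma ae_isConsistent_dualState (hB : IsBrownianReal B P)
    (hw : ∀ᵐ ω ∂P, IsInitialPath fun a => w a ω) (t : ℝ≥0) :
    ∀ᵐ ω ∂P, IsConsistent (dualState θ B w t ω) := by
  filter_upwards [ae_isDrivingPath θ hB, hw] with ω h1 h2
  exact h1.isConsistent_dualPath h2 t

lemma sample_dualState_ae_eq (hB : IsBrownianReal B P)
    (hw : ∀ᵐ ω ∂P, IsInitialPath fun a => w a ω) (t : ℝ≥0) :
    (fun ω => sample (dualState θ B w t ω)) =ᵐ[P]
      fun ω => dualSample θ t (initialSample w ω, fun i => B (sampleTime t i) ω) := by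
  filter_upwards [ae_isDrivingPath θ hB, hw] with ω h1 h2
  exact sample_stateOf_dualPath h1 h2 t

lemma aemeasurable_sample_dualState (hB : IsBrownianReal B P)
    (hw : ∀ᵐ ω ∂P, IsInitialPath fun a => w a ω) (hwm : ∀ a, AEMeasurable (w a) P) (t : ℝ≥0) :
    AEMeasurable (fun ω => sample (dualState θ B w t ω)) P :=
  ((measurable_dualSample θ t).comp_aemeasurable ((aemeasurable_initialSample hwm).prodMk
    (aemeasurable_brownian_sample hB.toIsPreBrownianReal _))).congr
      (sample_dualState_ae_eq θ hB hw t).symm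

lemma aemeasurable_dualState (hB : IsBrownianReal B P)
    (hw : ∀ᵐ ω ∂P, IsInitialPath fun a => w a ω) (hwm : ∀ a, AEMeasurable (w a) P) (t : ℝ≥0) :
    AEMeasurable (dualState θ B w t) P :=
  aemeasurable_of_isConsistent (ae_isConsistent_dualState θ hB hw t)
    (aemeasurable_sample_dualState θ hB hw hwm t)

/-- The law of the dual state only depends on the law of the initial condition, provided that the
latter is independent of the driving Brownian motion up to time `t`. -/
lemma map_dualState_eq (hB : IsBrownianReal B P) (hB' : IsBrownianReal B' P')
    (hw : ∀ᵐ ω ∂P, IsInitialPath fun a => w a ω) (hw' : ∀ᵐ ω ∂P', IsInitialPath fun a => w' a ω)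
    (hwm : ∀ a, AEMeasurable (w a) P) (hwm' : ∀ a, AEMeasurable (w' a) P') (t : ℝ≥0)
    (hind : IndepFun (initialSample w) (fun ω i => B (sampleTime t i) ω) P)
    (hind' : IndepFun (initialSample w') (fun ω i => B' (sampleTime t i) ω) P')
    (hlaw : P.map (initialSample w) = P'.map (initialSample w')) :
    P.map (dualState θ B w t) = P'.map (dualState θ B' w' t) := by
  refine map_eq_of_map_sample_eq (ae_isConsistent_dualState θ hB hw t)
    (ae_isConsistent_dualState θ hB' hw' t) (aemeasurable_sample_dualState θ hB hw hwm t)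
    (aemeasurable_sample_dualState θ hB' hw' hwm' t) ?_
  have m1 := aemeasurable_initialSample hwm
  have m1' := aemeasurable_initialSample hwm'
  have m2 := aemeasurable_brownian_sample hB.toIsPreBrownianReal (sampleTime t)
  have m2' := aemeasurable_brownian_sample hB'.toIsPreBrownianReal (sampleTime t)
  rw [Measure.map_congr (sample_dualState_ae_eq θ hB hw t),
    Measure.map_congr (sample_dualState_ae_eq θ hB' hw' t)]
  have e := (indepFun_iff_map_prod_eq_prod_map_map m1 m2).1 hind
  have e' := (indepFun_iff_map_prod_eq_prod_map_map m1' m2').1 hind'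
  rw [hlaw, map_brownian_sample_eq hB.toIsPreBrownianReal hB'.toIsPreBrownianReal, ← e'] at e
  have := congrArg (Measure.map (dualSample θ t)) e
  rwa [AEMeasurable.map_map_of_aemeasurable (measurable_dualSample θ t).aemeasurable
      (m1.prodMk m2),
    AEMeasurable.map_map_of_aemeasurable (measurable_dualSample θ t).aemeasurable
      (m1'.prodMk m2')] at this

/-! ### The law of the maximum -/

lemma ae_isConsistent_maxState (hB : IsBrownianReal B P) :
    ∀ᵐ ω ∂P, IsConsistent (maxState θ B ω) := by
  filter_upwards [ae_isDrivingPath θ hB] with ω h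
  exact h.isConsistent_maxPath

/-- The maximum process as an initial condition. -/
noncomputable def maxInitial (B : ℝ≥0 → Ω → ℝ) (a : ℝ≥0) (ω : Ω) : ℝ := maxProcess θ B ω a

lemma initialSample_maxInitial_ae_eq (hB : IsBrownianReal B P) :
    initialSample (maxInitial θ B) =ᵐ[P] fun ω => maxSample θ fun k => B (sampleSize k) ω := by
  filter_upwards [ae_isDrivingPath θ hB] with ω h
  exact maxPath_sampleSize h

lemma ae_isInitialPath_maxInitial (hB : IsBrownianReal B P) :
    ∀ᵐ ω ∂P, IsInitialPath fun a => maxInitial θ B a ω := by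
  filter_upwards [ae_isDrivingPath θ hB] with ω h
  exact h.isInitialPath_maxPath

lemma map_initialSample_maxInitial_eq (hB : IsBrownianReal B P) (hB' : IsBrownianReal B' P') :
    P.map (initialSample (maxInitial θ B)) = P'.map (initialSample (maxInitial θ B')) := by
  rw [Measure.map_congr (initialSample_maxInitial_ae_eq θ hB),
    Measure.map_congr (initialSample_maxInitial_ae_eq θ hB')]
  have := congrArg (Measure.map (maxSample θ)) (map_brownian_sample_eq hB.toIsPreBrownianReal
    hB'.toIsPreBrownianReal sampleSize)
  rwa [AEMeasurable.map_map_of_aemeasurable (measurable_maxSample θ).aemeasurable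
      (aemeasurable_brownian_sample hB.toIsPreBrownianReal _),
    AEMeasurable.map_map_of_aemeasurable (measurable_maxSample θ).aemeasurable
      (aemeasurable_brownian_sample hB'.toIsPreBrownianReal _)] at this

lemma sample_maxState_ae_eq (hB : IsBrownianReal B P) :
    (fun ω => sample (maxState θ B ω)) =ᵐ[P] initialSample (maxInitial θ B) := by
  filter_upwards [ae_isDrivingPath θ hB] with ω h
  exact sample_stateOf_maxPath h

lemma aemeasurable_sample_maxState (hB : IsBrownianReal B P) :
    AEMeasurable (fun ω => sample (maxState θ B ω)) P :=
  (aemeasurable_initialSample fun a => aemeasurable_maxProcess θ hB a).congr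
    (sample_maxState_ae_eq θ hB).symm

lemma aemeasurable_maxState (hB : IsBrownianReal B P) : AEMeasurable (maxState θ B) P :=
  aemeasurable_of_isConsistent (ae_isConsistent_maxState θ hB) (aemeasurable_sample_maxState θ hB)

/-- The law of the maximum does not depend on the Brownian motion. -/
lemma map_maxState_eq (hB : IsBrownianReal B P) (hB' : IsBrownianReal B' P') :
    P.map (maxState θ B) = P'.map (maxState θ B') := by
  refine map_eq_of_map_sample_eq (ae_isConsistent_maxState θ hB) (ae_isConsistent_maxState θ hB')
    (aemeasurable_sample_maxState θ hB) (aemeasurable_sample_maxState θ hB') ?_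
  rw [Measure.map_congr (sample_maxState_ae_eq θ hB),
    Measure.map_congr (sample_maxState_ae_eq θ hB')]
  exact map_initialSample_maxInitial_eq θ hB hB'

/-! ### The scaling limit -/

lemma ae_isStateOf_scalingLimit (hB : IsBrownianReal B P) (hw : IsFiniteInitialCondition w B P)
    (t : ℝ≥0) : ∀ᵐ ω ∂P, IsStateOf (workload θ B w t ω) (scalingLimit θ B w t ω) := by
  filter_upwards [ae_workload_eq_dualPath θ hB hw t,
    ae_isDrivingPath θ (isBrownianReal_reversePath hB t), hw.ae_isInitialPath] with ω h1 h2 h3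
  rw [scalingLimit, h1]
  exact h2.isStateOf_dualPath h3 t

lemma aemeasurable_scalingLimit (hB : IsBrownianReal B P) (hw : IsFiniteInitialCondition w B P)
    (t : ℝ≥0) : AEMeasurable (scalingLimit θ B w t) P :=
  (aemeasurable_dualState θ (isBrownianReal_reversePath hB t) hw.ae_isInitialPath
    hw.aemeasurable t).congr (scalingLimit_ae_eq θ hB hw t).symm

/-- The scaling limit at a fixed time has the law of the dual state. -/
lemma map_scalingLimit_eq (hB : IsBrownianReal B P) (hw : IsFiniteInitialCondition w B P)
    (t : ℝ≥0) : P.map (scalingLimit θ B w t) = P.map (dualState θ B w t) := by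
  rw [Measure.map_congr (scalingLimit_ae_eq θ hB hw t)]
  refine map_dualState_eq θ (isBrownianReal_reversePath hB t) hB hw.ae_isInitialPath
    hw.ae_isInitialPath hw.aemeasurable hw.aemeasurable t ?_ ?_ rfl
  · refine indepFun_initialSample hw (F := fun b i => reversePath b t (sampleTime t i))
      (measurable_pi_lambda _ fun i => ?_)
    unfold reversePath
    split_ifs <;> fun_prop
  · exact indepFun_initialSample hw (F := fun b i => b (sampleTime t i)) (by fun_prop)

/-- The dual state is eventually equal to the state of the maximum. -/
lemma ae_eventually_dualState_eq (hB : IsBrownianReal B P)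
    (hw : ∀ᵐ ω ∂P, IsInitialPath fun a => w a ω) :
    ∀ᵐ ω ∂P, ∀ᶠ t in atTop, dualState θ B w t ω = maxState θ B ω := by
  filter_upwards [ae_isDrivingPath θ hB, hw] with ω h1 h2
  filter_upwards [eventually_maxPath_eq_dualPath h1 h2] with t ht
  rw [dualState, maxState, maxProcess, ht]

/-- The scaling limit converges to the maximum, tested against bounded measurable functions. -/
lemma tendsto_integral_scalingLimit (hB : IsBrownianReal B P)
    (hw : IsFiniteInitialCondition w B P) {h : State → ℝ} (hh : Measurable h) {C : ℝ}
    (hC : ∀ s, ‖h s‖ ≤ C) :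
    Tendsto (fun t => ∫ s, h s ∂(P.map (scalingLimit θ B w t))) atTop
      (𝓝 (∫ s, h s ∂(P.map (maxState θ B)))) := by
  have hm := aemeasurable_dualState θ hB hw.ae_isInitialPath hw.aemeasurable
  have hM := aemeasurable_maxState θ hB
  simp only [map_scalingLimit_eq θ hB hw]
  rw [integral_map hM hh.aestronglyMeasurable]
  have e : ∀ t, ∫ s, h s ∂(P.map (dualState θ B w t)) = ∫ ω, h (dualState θ B w t ω) ∂P :=
    fun t => integral_map (hm t) hh.aestronglyMeasurable
  simp only [e]
  refine tendsto_integral_filter_of_dominated_convergence (fun _ => C)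
    (Eventually.of_forall fun t => (hh.comp_aemeasurable (hm t)).aestronglyMeasurable)
    (Eventually.of_forall fun t => ae_of_all _ fun ω => hC _) (integrable_const C) ?_
  filter_upwards [ae_eventually_dualState_eq θ hB hw.ae_isInitialPath] with ω hω
  exact tendsto_const_nhds.congr' (hω.mono fun t ht => congrArg h ht.symm)

theorem tendstoInDistribution_scalingLimit (hB : IsBrownianReal B P)
    (hw : IsFiniteInitialCondition w B P) :
    TendstoInDistribution (scalingLimit θ B w) atTop (maxState θ B) (fun _ => P) P where
  forall_aemeasurable := aemeasurable_scalingLimit θ hB hw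
  aemeasurable_limit := aemeasurable_maxState θ hB
  tendsto := by
    refine ProbabilityMeasure.tendsto_iff_forall_integral_tendsto.2 fun f => ?_
    exact tendsto_integral_scalingLimit θ hB hw f.continuous.measurable f.norm_coe_le_norm

/-! ### Stationarity -/

/-- A law that does not change along the scaling limit is the law of the maximum. -/
lemma eq_map_maxState_of_forall_map_eq (hB : IsBrownianReal B P)
    (hw : IsFiniteInitialCondition w B P) {π : Measure State}
    (h : ∀ t, P.map (scalingLimit θ B w t) = π) : π = P.map (maxState θ B) := by
  have : IsProbabilityMeasure π :=
    h 0 ▸ Measure.isProbabilityMeasure_map (aemeasurable_scalingLimit θ hB hw 0)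
  have := Measure.isProbabilityMeasure_map (aemeasurable_maxState θ hB)
  refine Measure.ext fun U hU => ?_
  have hlim := tendsto_integral_scalingLimit θ hB hw
    (h := U.indicator fun _ => (1 : ℝ)) (measurable_const.indicator hU) (C := 1) fun s => by
      by_cases hs : s ∈ U <;> simp [hs]
  simp only [h, integral_indicator_const (1 : ℝ) hU, smul_eq_mul, mul_one] at hlim
  have := tendsto_nhds_unique tendsto_const_nhds hlim
  exact (measureReal_eq_measureReal_iff).1 this

lemma reflectedPath_zero_time {b w : ℝ≥0 → ℝ} {a : ℝ≥0∞} (hb0 : b 0 = 0)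
    (hw : 0 ≤ extendInfty w a) : reflectedPath θ.σ θ.μ b w 0 a = extendInfty w a := by
  simp [reflectedPath, skorokhodMap, coupledPath_zero_left hb0, hw]

/-- The workload at time zero is the initial condition. -/
lemma sample_scalingLimit_zero_ae_eq (hB : IsBrownianReal B P)
    (hw : IsFiniteInitialCondition w B P) :
    (fun ω => sample (scalingLimit θ B w 0 ω)) =ᵐ[P] initialSample w := by
  filter_upwards [ae_isStateOf_scalingLimit θ hB hw 0, hB.eval_zero_ae_eq_zero,
    hw.ae_isInitialPath] with ω h1 h2 h3
  funext n
  rw [sample, h1.workload]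
  have h0 : 0 ≤ extendInfty (fun a => w a ω) (sampleSize n) := by
    rw [extendInfty_coe]; exact h3.nonneg _
  exact (reflectedPath_zero_time θ h2 h0).trans (extendInfty_coe _ _)

lemma measurable_sample : Measurable sample :=
  measurable_pi_lambda _ fun _ =>
    ((continuous_eval_const _).comp continuous_fst).measurable

/-- The law of the maximum is invariant. -/
lemma map_scalingLimit_eq_of_map_zero_eq (hB : IsBrownianReal B P) (hB' : IsBrownianReal B' P')
    (hw : IsFiniteInitialCondition w B P)
    (h : P.map (scalingLimit θ B w 0) = P'.map (maxState θ B')) (t : ℝ≥0) :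
    P.map (scalingLimit θ B w t) = P'.map (maxState θ B') := by
  have hs := hB'.shift t
  set S : ℝ≥0 → Ω' → ℝ := fun s ω => B' (t + s) ω - B' t ω with hS
  have hmax : P'.map (maxState θ B') = P'.map (dualState θ B' (maxInitial θ S) t) := by
    refine Measure.map_congr ?_
    filter_upwards [ae_isDrivingPath θ hB', ae_isDrivingPath θ hs] with ω h1 h2
    have := dualPath_maxPath_shift h1 h2
    rw [maxState, maxProcess, ← this]
    rfl
  rw [hmax, map_scalingLimit_eq θ hB hw]
  refine map_dualState_eq θ hB hB' hw.ae_isInitialPath (ae_isInitialPath_maxInitial θ hs)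
    hw.aemeasurable (fun a => aemeasurable_maxProcess θ hs a) t ?_ ?_ ?_
  · exact indepFun_initialSample hw (F := fun b i => b (sampleTime t i)) (by fun_prop)
  · have hle : ∀ i, sampleTime t i ≤ t
      | none => le_rfl
      | some k => min_le_right _ _
    have := (hB'.indepFun_shift t).comp
      (φ := fun y => maxSample θ fun k => y (sampleSize k))
      (ψ := fun (y : Set.Iic t → ℝ) (i : Option ℕ) => y ⟨sampleTime t i, hle i⟩)
      ((measurable_maxSample θ).comp (by fun_prop)) (by fun_prop)
    exact this.congr (initialSample_maxInitial_ae_eq θ hs).symm ae_eq_rfl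
  · have e := congrArg (Measure.map sample) h
    rw [AEMeasurable.map_map_of_aemeasurable measurable_sample.aemeasurable
        (aemeasurable_scalingLimit θ hB hw 0),
      AEMeasurable.map_map_of_aemeasurable measurable_sample.aemeasurable
        (aemeasurable_maxState θ hB')] at e
    have e1 : P.map (sample ∘ scalingLimit θ B w 0) = P.map (initialSample w) :=
      Measure.map_congr (sample_scalingLimit_zero_ae_eq θ hB hw)
    have e2 : P'.map (sample ∘ maxState θ B') = P'.map (initialSample (maxInitial θ B')) :=
      Measure.map_congr (sample_maxState_ae_eq θ hB')
    exact (e1.symm.trans (e.trans e2)).trans (map_initialSample_maxInitial_eq θ hB' hs)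

lemma indepFun_fst_snd {α β : Type*} [MeasurableSpace α] [MeasurableSpace β] (f : Ω → α)
    (g : Ω' → β) : IndepFun (fun ω : Ω × Ω' => f ω.1) (fun ω => g ω.2) (P.prod P') := by
  rw [indepFun_iff_measure_inter_preimage_eq_mul]
  intro s t _ _
  have h1 : (fun ω : Ω × Ω' => f ω.1) ⁻¹' s = (f ⁻¹' s) ×ˢ Set.univ := by ext; simp
  have h2 : (fun ω : Ω × Ω' => g ω.2) ⁻¹' t = Set.univ ×ˢ (g ⁻¹' t) := by ext; simp
  rw [h1, h2, Set.prod_inter_prod, Set.inter_univ, Set.univ_inter, Measure.prod_prod,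
    Measure.prod_prod, Measure.prod_prod, measure_univ, measure_univ, one_mul, mul_one]

lemma isBrownianReal_comp_snd (hB' : IsBrownianReal B' P') :
    IsBrownianReal (fun t (ω : Ω × Ω') => B' t ω.2) (P.prod P') where
  hasLaw I := (hB'.hasLaw I).comp measurePreserving_snd.hasLaw
  cont := measurePreserving_snd.quasiMeasurePreserving.ae hB'.cont

/-- The maximum of an independent Brownian motion is a finite initial condition. -/
lemma isFiniteInitialCondition_maxInitial (hB : IsBrownianReal B P) :
    IsFiniteInitialCondition (fun a (ω : Ω × Ω') => maxInitial θ B a ω.1) (fun t ω => B' t ω.2)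
      (P.prod P') where
  aemeasurable a := (aemeasurable_maxProcess θ hB a).comp_fst
  indep := indepFun_fst_snd (fun ω a => maxInitial θ B a ω) (fun ω t => B' t ω)
  paths := by
    filter_upwards [measurePreserving_fst.quasiMeasurePreserving.ae
      (ae_isInitialPath_maxInitial θ hB)] with ω h
    exact ⟨h.cont, h.mono, h.zero⟩
  near_zero := by
    have hD : AEMeasurable (fun ω => dyadicSum fun a => maxProcess θ B ω a) P :=
      AEMeasurable.tsum fun n =>
        ((aemeasurable_maxProcess θ hB _).ennreal_ofReal).const_mul _
    calc _ ≤ ∫⁻ ω, 2 * dyadicSum (fun a => maxProcess θ B ω.1 a) ∂(P.prod P') := by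
          refine lintegral_mono_ae ?_
          filter_upwards [measurePreserving_fst.quasiMeasurePreserving.ae
            (ae_isInitialPath_maxInitial θ hB)] with ω h
          exact lintegral_Ioc_le_dyadicSum h.mono h.zero
      _ = 2 * ∫⁻ ω, dyadicSum (fun a => maxProcess θ B ω a) ∂P := by
          rw [lintegral_const_mul'' _ hD.comp_fst]
          congr 1
          have := lintegral_map' (g := Prod.fst) (μ := P.prod P')
            (f := fun ω => dyadicSum fun a => maxProcess θ B ω a)
            (by rwa [measurePreserving_fst.map_eq]) measurable_fst.aemeasurable
          rw [measurePreserving_fst.map_eq] at this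
          exact this.symm
      _ < ⊤ := ENNReal.mul_lt_top (by simp) (lintegral_dyadicSum_maxProcess_lt_top θ hB)
  at_infty := by
    have hM := (aemeasurable_maxProcess θ hB ⊤).ennreal_ofReal
    calc _ ≤ ∫⁻ ω, ENNReal.ofReal (maxProcess θ B ω.1 ⊤) ∂(P.prod P') := by
          refine lintegral_mono_ae ?_
          filter_upwards [measurePreserving_fst.quasiMeasurePreserving.ae
            (ae_isDrivingPath θ hB)] with ω h
          have hI := h.isInitialPath_maxPath
          rw [show valueAtInfty (fun a => maxInitial θ B a ω.1) = _ from
            valueAtInfty_eq_iSup hI.mono]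
          refine iSup_le fun a => ENNReal.ofReal_le_ofReal ?_
          have := hI.extendInfty_mono (le_top (a := (a : ℝ≥0∞)))
          rw [h.extendInfty_maxPath] at this
          exact this
      _ = ∫⁻ ω, ENNReal.ofReal (maxProcess θ B ω ⊤) ∂P := by
          have := lintegral_map' (g := Prod.fst) (μ := P.prod P')
            (f := fun ω => ENNReal.ofReal (maxProcess θ B ω ⊤))
            (by rwa [measurePreserving_fst.map_eq]) measurable_fst.aemeasurable
          rw [measurePreserving_fst.map_eq] at this
          exact this.symm
      _ < ⊤ := (lintegral_maxProcess_le θ hB (by simp)).trans_lt ENNReal.ofReal_lt_top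

end Laws

section Stationary

variable {Ω : Type u} [MeasurableSpace Ω] {P : Measure Ω} [IsProbabilityMeasure P]
  {B : ℝ≥0 → Ω → ℝ} (θ : Params)

lemma map_scalingLimit_zero_maxInitial (hB : IsBrownianReal B P) :
    (P.prod P).map (scalingLimit θ (fun t ω => B t ω.2) (fun a ω => maxInitial θ B a ω.1) 0) =
      P.map (maxState θ B) := by
  have hB2 : IsBrownianReal (fun t (ω : Ω × Ω) => B t ω.2) (P.prod P) :=
    isBrownianReal_comp_snd hB
  have hm := aemeasurable_maxState θ hB
  have e : scalingLimit θ (fun t ω => B t ω.2) (fun a ω => maxInitial θ B a ω.1) 0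
      =ᵐ[P.prod P] fun ω => maxState θ B ω.1 := by
    filter_upwards [measurePreserving_fst.quasiMeasurePreserving.ae (ae_isDrivingPath θ hB),
      hB2.eval_zero_ae_eq_zero] with ω h h0
    rw [scalingLimit, maxState]
    congr 1
    funext a
    have hpos : 0 ≤ maxPath θ.σ θ.μ (fun s => B s ω.1) a := by
      have := h.coupledPath_le_maxPath 0 a
      rwa [coupledPath_zero_left h.zero] at this
    rw [← h.extendInfty_maxPath] at hpos
    exact (reflectedPath_zero_time θ h0 hpos).trans (congrFun h.extendInfty_maxPath a)
  rw [Measure.map_congr e]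
  have := AEMeasurable.map_map_of_aemeasurable (μ := P.prod P) (f := Prod.fst)
    (g := maxState θ B) (by rwa [measurePreserving_fst.map_eq]) measurable_fst.aemeasurable
  rw [measurePreserving_fst.map_eq] at this
  exact this.symm

theorem isStationaryLaw_map_maxState (hB : IsBrownianReal B P) :
    IsStationaryLaw.{u} θ (P.map (maxState θ B)) where
  isProbabilityMeasure := Measure.isProbabilityMeasure_map (aemeasurable_maxState θ hB)
  realizable := ⟨Ω × Ω, inferInstance, P.prod P, fun t ω => B t ω.2,
    fun a ω => maxInitial θ B a ω.1, inferInstance, isBrownianReal_comp_snd hB,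
    isFiniteInitialCondition_maxInitial θ hB, map_scalingLimit_zero_maxInitial θ hB⟩
  invariant _ _ _ _ _ _ hB' hw h t := map_scalingLimit_eq_of_map_zero_eq θ hB' hB hw h t

theorem IsStationaryLaw.eq_map_maxState (hB : IsBrownianReal B P) {π : Measure State}
    (hπ : IsStationaryLaw.{u} θ π) : π = P.map (maxState θ B) := by
  obtain ⟨Ω', _, P', B', w, _, hB', hw, h0⟩ := hπ.realizable
  exact (eq_map_maxState_of_forall_map_eq θ hB' hw (hπ.invariant Ω' P' B' w hB' hw h0)).trans
    (map_maxState_eq θ hB' hB)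

end Stationary

end SRPT

theorem mainTheorem8 (θ : SRPT.Params) (Ω : Type u) [MeasurableSpace Ω] (P : Measure Ω)
    [IsProbabilityMeasure P] (B : ℝ≥0 → Ω → ℝ) (hB : IsBrownianReal B P) :
    -- the maximum process is finite, and it defines a random element of the state space
    (∀ᵐ ω ∂P,
      (∀ a : ℝ≥0∞, BddAbove (Set.range fun t : ℝ≥0 =>
        SRPT.coupledPath θ.σ θ.μ (fun s => B s ω) t a)) ∧
      SRPT.IsStateOf (SRPT.maxProcess θ B ω) (SRPT.maxState θ B ω)) ∧
    -- for each finite initial condition, the scaling limit is well defined and converges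
    (∀ w : ℝ≥0 → Ω → ℝ, SRPT.IsFiniteInitialCondition w B P →
      (∀ t : ℝ≥0, ∀ᵐ ω ∂P,
        SRPT.IsStateOf (SRPT.workload θ B w t ω) (SRPT.scalingLimit θ B w t ω)) ∧
      TendstoInDistribution (SRPT.scalingLimit θ B w) atTop (SRPT.maxState θ B)
        (fun _ => P) P) ∧
    -- the law of the limit is the unique stationary distribution
    SRPT.IsStationaryLaw.{u} θ (P.map (SRPT.maxState θ B)) ∧
    ∀ π : Measure SRPT.State, SRPT.IsStationaryLaw.{u} θ π → π = P.map (SRPT.maxState θ B) := by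
  refine ⟨?_, fun w hw => ⟨SRPT.ae_isStateOf_scalingLimit θ hB hw,
    SRPT.tendstoInDistribution_scalingLimit θ hB hw⟩, SRPT.isStationaryLaw_map_maxState θ hB,
    fun π hπ => hπ.eq_map_maxState θ hB⟩
  filter_upwards [SRPT.ae_isDrivingPath θ hB] with ω h
  exact ⟨h.bddAbove, h.isStateOf_maxPath⟩
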